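/- Let $R$ be a measurable function on the unit circle $\mathbb T$ (with normalized Lebesgue measure) such that $|R|\le 1$ almost everywhere and $\log(1-|R|)\in L^1$ (in particular $|R|<1$ almost everywhere). Let $L^R$ be the space of (classes of) measurable functions $f=\begin{bmatrix} f_1\\ f_2\end{bmatrix}:\mathbb T\to\mathbb C^2$ of finite norm for the inner product $$\langle f,g\rangle=\int_{\mathbb T} g^*\begin{bmatrix}1&\overline R\\ R&1\end{bmatrix}^{-1}f ,$$ and let $U_R$ be the unitary operator on $L^R$ of multiplication by the independent variable $t$. Let $H^2_+\subset L^2$ be the Hardy space and $H^2_-=L^2\ominus H^2_+$. For integers $n,m$ put $$\check{\mathcal H}_{n,m}=\operatorname{Clos}\left\{\begin{bmatrix}1&\overline R\\ R&1\end{bmatrix}\begin{bmatrix}g_1\\ g_2\end{bmatrix}:\ g_1\in t^nH^2_+,\ g_2\in\overline t^{\,m}H^2_-\right\}\subset L^R,\qquad e_n=\begin{bmatrix}1\\ R\end{bmatrix}t^n,\qquad d_m=\begin{bmatrix}\overline R\\ 1\end{bmatrix}\overline t^{\,m+1}.$$ Then the following hold. 1. For all integers $n,m$, the subspaces $\check{\mathcal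 H}_{n+1,m}$ and $\check{\mathcal H}_{n,m+1}$ are contained in $\check{\mathcal H}_{n,m}$ with codimension one. Consequently there are a unique unit vector $\check K_{n,m}\in\check{\mathcal H}_{n,m}\ominus\check{\mathcal H}_{n+1,m}$ with $\langle \check K_{n,m},e_n\rangle>0$ and a unique unit vector $\widetilde{\check K}_{n,m}\in\check{\mathcal H}_{n,m}\ominus\check{\mathcal H}_{n,m+1}$ with $\langle\widetilde{\check K}_{n,m},d_m\rangle>0$. 2. There are complex numbers $\check\alpha_k$ ($k\in\mathbb Z$) with $|\check\alpha_k|<1$ such that, with $\check\rho_k=\sqrt{1-|\check\alpha_k|^2}$, for all integers $n,m$ one has $\check\alpha_{n+m}=\langle\check K_{n,m},\widetilde{\check K}_{n,m}\rangle$ and $$\begin{bmatrix}\check K_{n,m}&\widetilde{\check K}_{n+1,m}\end{bmatrix}=\begin{bmatrix}\widetilde{\check K}_{n,m}&\check K_{n,m+1}\end{bmatrix}\begin{bmatrix}\check\alpha_{n+m}&\check\rho_{n+m}\\ \check\rho_{n+m}&-\overline{\check\alpha}_{n+m}\end{bmatrix}.$$ 3. For every integer $n$, $$\begin{bmatrix}U_R\check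 K_{n,n}&U_R\widetilde{\check K}_{n+1,n}\end{bmatrix}=\begin{bmatrix}\widetilde{\check K}_{n,n-1}&\check K_{n,n}&\widetilde{\check K}_{n+1,n}&\check K_{n+1,n+1}\end{bmatrix}\begin{bmatrix}\check\rho_{2n-1}&0\\ -\overline{\check\alpha}_{2n-1}&0\\ 0&\check\alpha_{2n+1}\\ 0&\check\rho_{2n+1}\end{bmatrix}\begin{bmatrix}\check\alpha_{2n}&\check\rho_{2n}\\ \check\rho_{2n}&-\overline{\check\alpha}_{2n}\end{bmatrix}.$$ 4. The vectors $v_{2n}=\check K_{n,n}$, $v_{2n+1}=\widetilde{\check K}_{n+1,n}$ ($n\in\mathbb Z$), that is, $\ldots,\check K_{n,n},\widetilde{\check K}_{n+1,n},\check K_{n+1,n+1},\widetilde{\check K}_{n+2,n+1},\ldots$, form an orthonormal basis of $L^R$. In this basis the matrix of $U_R$ is the two-sided CMV matrix $\mathcal M\mathcal L$. Here $\mathcal L$ and $\mathcal M$ are the infinite block diagonal matrices, with rows and columns indexed by $\mathbb Z$, whose diagonal blocks are $$\begin{bmatrix}\check\alpha_k&\check\rho_k\\ \check\rho_k&-\overline{\check\alpha}_k\end{bmatrix}\quad\text{in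 rows and columns } k,k+1,$$ with $k$ running over the even integers for $\mathcal L$ and over the odd integers for $\mathcal M$. -/

import Mathlib

open MeasureTheory AddCircle
open scoped ComplexConjugate Matrix ComplexOrder

namespace ScatteringCMV

/-- The unit circle, parametrized by `θ ↦ t = exp (2 π i θ)`. The independent variable `t` is the
function `fourier 1`, and `t ^ n` is `fourier n`. -/
abbrev 𝕋 : Type := AddCircle (1 : ℝ)

/-- The normalized Lebesgue measure on the circle. -/
noncomputable abbrev leb : Measure 𝕋 := haarAddCircle

/-- The space `L²` of scalar functions on the circle. -/
noncomputable abbrev LTwo : Type := Lp ℂ 2 leb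

/-- A contractive function `R` on the circle satisfying the Szegő condition `log (1 - |R|) ∈ L¹`.
As `Real.log 0 = 0`, the condition that `log (1 - |R|)` is finite almost everywhere (which is part
of its integrability) is spelled out as `|R| < 1` almost everywhere. -/
structure SzegoFunction where
  /-- the underlying function -/
  toFun : 𝕋 → ℂ
  aestronglyMeasurable : AEStronglyMeasurable toFun leb
  norm_lt_one : ∀ᵐ t ∂leb, ‖toFun t‖ < 1
  integrable_log : Integrable (fun t => Real.log (1 - ‖toFun t‖)) leb

instance : CoeFun SzegoFunction (fun _ => 𝕋 → ℂ) := ⟨SzegoFunction.toFun⟩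

/-- The matrix `[1, z̄; z, 1]`. -/
def gram (z : ℂ) : Matrix (Fin 2) (Fin 2) ℂ := !![1, conj z; z, 1]

/-- The sesquilinear form `u* [1, z̄; z, 1]⁻¹ v`, conjugate linear in `u` and linear in `v`. -/
noncomputable def form (z : ℂ) (u v : Fin 2 → ℂ) : ℂ := star u ⬝ᵥ ((gram z)⁻¹ *ᵥ v)

theorem form_add_left (z : ℂ) (u v w : Fin 2 → ℂ) : form z (u + v) w = form z u w + form z v w := by
  simp [form, add_dotProduct]

theorem form_smul_left (z c : ℂ) (u v : Fin 2 → ℂ) : form z (c • u) v = conj c * form z u v := by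
  simp [form, smul_dotProduct]

theorem one_sub_ne {z : ℂ} (hz : ‖z‖ < 1) : (1 - conj z * z : ℂ) ≠ 0 := by
  have h : (1 - conj z * z : ℂ) = ((1 - ‖z‖ ^ 2 : ℝ) : ℂ) := by
    rw [Complex.conj_mul']; push_cast; ring
  rw [h]
  have : (1 - ‖z‖ ^ 2 : ℝ) ≠ 0 := by nlinarith [norm_nonneg z]
  exact_mod_cast this

theorem form_eq {z : ℂ} (hz : ‖z‖ < 1) (u v : Fin 2 → ℂ) :
    form z u v = conj (u 0) * v 0 +
      conj (u 1 - z * u 0) * (v 1 - z * v 0) * (((1 - ‖z‖ ^ 2)⁻¹ : ℝ) : ℂ) := by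
  have h := one_sub_ne hz
  have h' : (((1 - ‖z‖ ^ 2)⁻¹ : ℝ) : ℂ) = (1 - conj z * z)⁻¹ := by
    rw [Complex.conj_mul']; push_cast; ring
  rw [h']
  simp only [form, gram, Matrix.inv_def, Matrix.det_fin_two_of, Matrix.adjugate_fin_two_of,
    Ring.inverse_eq_inv', Matrix.smul_mulVec, dotProduct_smul, smul_eq_mul, one_mul]
  simp only [dotProduct, Matrix.mulVec, Fin.sum_univ_two, Pi.star_apply, RCLike.star_def,
    Matrix.of_apply, Matrix.cons_val', Matrix.cons_val_zero, Matrix.cons_val_one,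
    Matrix.cons_val_fin_one, map_sub, map_mul]
  field_simp
  ring

/-- The real quadratic form of `form`. -/
noncomputable def quad (z : ℂ) (u : Fin 2 → ℂ) : ℝ :=
  ‖u 0‖ ^ 2 + ‖u 1 - z * u 0‖ ^ 2 * (1 - ‖z‖ ^ 2)⁻¹

theorem form_self {z : ℂ} (hz : ‖z‖ < 1) (u : Fin 2 → ℂ) : form z u u = (quad z u : ℂ) := by
  rw [form_eq hz, quad, Complex.conj_mul', Complex.conj_mul']
  push_cast
  ring

theorem inv_nonneg_of_lt {z : ℂ} (hz : ‖z‖ < 1) : 0 < (1 - ‖z‖ ^ 2)⁻¹ := by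
  have : 0 < 1 - ‖z‖ ^ 2 := by nlinarith [norm_nonneg z]
  positivity

theorem quad_nonneg {z : ℂ} (hz : ‖z‖ < 1) (u : Fin 2 → ℂ) : 0 ≤ quad z u := by
  have := inv_nonneg_of_lt hz
  unfold quad
  positivity

theorem norm_add_sq_le (a b : ℂ) : ‖a + b‖ ^ 2 ≤ 2 * ‖a‖ ^ 2 + 2 * ‖b‖ ^ 2 := by
  have h := norm_add_le a b
  nlinarith [norm_nonneg (a + b), sq_nonneg (‖a‖ - ‖b‖)]

theorem quad_add_le {z : ℂ} (hz : ‖z‖ < 1) (u v : Fin 2 → ℂ) :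
    quad z (u + v) ≤ 2 * quad z u + 2 * quad z v := by
  have h0 := inv_nonneg_of_lt hz
  have h1 := norm_add_sq_le (u 0) (v 0)
  have h2 := norm_add_sq_le (u 1 - z * u 0) (v 1 - z * v 0)
  have h3 : (u + v) 1 - z * (u + v) 0 = (u 1 - z * u 0) + (v 1 - z * v 0) := by
    simp only [Pi.add_apply]; ring
  have h4 := mul_le_mul_of_nonneg_right h2 h0.le
  unfold quad
  rw [h3, Pi.add_apply]
  linarith

theorem norm_form_le {z : ℂ} (hz : ‖z‖ < 1) (u v : Fin 2 → ℂ) :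
    ‖form z u v‖ ≤ quad z u + quad z v := by
  have h0 := inv_nonneg_of_lt hz
  rw [form_eq hz]
  refine (norm_add_le _ _).trans ?_
  rw [norm_mul, norm_mul, norm_mul, RCLike.norm_conj, RCLike.norm_conj, Complex.norm_real,
    Real.norm_of_nonneg h0.le]
  have h1 : ‖u 0‖ * ‖v 0‖ ≤ ‖u 0‖ ^ 2 + ‖v 0‖ ^ 2 := by
    nlinarith [sq_nonneg (‖u 0‖ - ‖v 0‖), sq_nonneg (‖u 0‖), sq_nonneg (‖v 0‖)]
  have h2 : ‖u 1 - z * u 0‖ * ‖v 1 - z * v 0‖ ≤ ‖u 1 - z * u 0‖ ^ 2 + ‖v 1 - z * v 0‖ ^ 2 := by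
    nlinarith [sq_nonneg (‖u 1 - z * u 0‖ - ‖v 1 - z * v 0‖), sq_nonneg (‖u 1 - z * u 0‖),
      sq_nonneg (‖v 1 - z * v 0‖)]
  have h3 := mul_le_mul_of_nonneg_right h2 h0.le
  unfold quad
  linarith

theorem quad_eq_zero {z : ℂ} (hz : ‖z‖ < 1) {u : Fin 2 → ℂ} (h : quad z u = 0) : u = 0 := by
  have h0 := inv_nonneg_of_lt hz
  have h1 : 0 ≤ ‖u 1 - z * u 0‖ ^ 2 * (1 - ‖z‖ ^ 2)⁻¹ := by positivity
  have h2 : ‖u 0‖ ^ 2 = 0 := by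
    have := sq_nonneg (‖u 0‖); unfold quad at h; linarith
  have h3 : u 0 = 0 := by simpa using h2
  have h4 : ‖u 1 - z * u 0‖ ^ 2 * (1 - ‖z‖ ^ 2)⁻¹ = 0 := by unfold quad at h; linarith
  have h5 : u 1 = 0 := by
    rcases mul_eq_zero.mp h4 with h | h
    · simpa [h3] using h
    · exact absurd h h0.ne'
  funext i
  fin_cases i
  · exact h3
  · exact h5

theorem form_conj {z : ℂ} (hz : ‖z‖ < 1) (u v : Fin 2 → ℂ) : conj (form z u v) = form z v u := by
  rw [form_eq hz, form_eq hz]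
  simp only [map_add, map_mul, map_sub, Complex.conj_conj, Complex.conj_ofReal]
  ring

variable (R : SzegoFunction)

theorem aestronglyMeasurable_form (f g : 𝕋 →ₘ[leb] (Fin 2 → ℂ)) :
    AEStronglyMeasurable (fun t => form (R t) (f t) (g t)) leb := by
  have hR : AEMeasurable R.toFun leb := R.aestronglyMeasurable.aemeasurable
  have hf : AEMeasurable (fun t => f t) leb := f.aemeasurable
  have hg : AEMeasurable (fun t => g t) leb := g.aemeasurable
  have hf0 : ∀ i, AEMeasurable (fun t => f t i) leb := fun i => (aemeasurable_pi_iff.mp hf) i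
  have hg0 : ∀ i, AEMeasurable (fun t => g t i) leb := fun i => (aemeasurable_pi_iff.mp hg) i
  have key : AEMeasurable (fun t => conj (f t 0) * g t 0 +
      conj (f t 1 - R t * f t 0) * (g t 1 - R t * g t 0) *
        (((1 - ‖R t‖ ^ 2)⁻¹ : ℝ) : ℂ)) leb := by
    have hc : ∀ {h : 𝕋 → ℂ}, AEMeasurable h leb → AEMeasurable (fun t => conj (h t)) leb :=
      fun hh => Complex.continuous_conj.measurable.comp_aemeasurable hh
    refine ((hc (hf0 0)).mul (hg0 0)).add (((hc ((hf0 1).sub (hR.mul (hf0 0)))).mul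
      ((hg0 1).sub (hR.mul (hg0 0)))).mul ?_)
    exact Complex.measurable_ofReal.comp_aemeasurable
      ((aemeasurable_const.sub (hR.norm.pow_const 2)).inv)
  refine key.aestronglyMeasurable.congr ?_
  filter_upwards [R.norm_lt_one] with t ht
  rw [form_eq ht]

/-- `f` has finite weighted norm: `∫ f* [1, R̄; R, 1]⁻¹ f < ∞`. -/
def HasFiniteNorm (f : 𝕋 →ₘ[leb] (Fin 2 → ℂ)) : Prop :=
  Integrable (fun t => form (R t) (f t) (f t)) leb

variable {R}

theorem HasFiniteNorm.quad {f : 𝕋 →ₘ[leb] (Fin 2 → ℂ)} (hf : HasFiniteNorm R f) :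
    Integrable (fun t => quad (R t) (f t)) leb := by
  refine hf.re.congr ?_
  filter_upwards [R.norm_lt_one] with t ht
  simp [form_self ht]

theorem HasFiniteNorm.integrable {f g : 𝕋 →ₘ[leb] (Fin 2 → ℂ)} (hf : HasFiniteNorm R f)
    (hg : HasFiniteNorm R g) : Integrable (fun t => form (R t) (f t) (g t)) leb := by
  refine (hf.quad.add hg.quad).mono' (aestronglyMeasurable_form R f g) ?_
  filter_upwards [R.norm_lt_one] with t ht
  exact norm_form_le ht _ _

theorem HasFiniteNorm.of_le {f : 𝕋 →ₘ[leb] (Fin 2 → ℂ)} {b : 𝕋 → ℝ} (hb : Integrable b leb)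
    (h : ∀ᵐ t ∂leb, ‖R t‖ < 1 → ScatteringCMV.quad (R t) (f t) ≤ b t) : HasFiniteNorm R f := by
  refine hb.mono' (aestronglyMeasurable_form R f f) ?_
  filter_upwards [R.norm_lt_one, h] with t ht h
  rw [form_self ht, Complex.norm_real, Real.norm_of_nonneg (quad_nonneg ht _)]
  exact h ht

variable (R)

/-- The vector space of (classes of) measurable `ℂ²`-valued functions of finite weighted norm. -/
def LRSubmodule : Submodule ℂ (𝕋 →ₘ[leb] (Fin 2 → ℂ)) where
  carrier := {f | HasFiniteNorm R f}
  zero_mem' := by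
    refine HasFiniteNorm.of_le (integrable_zero _ _ _) ?_
    filter_upwards [AEEqFun.coeFn_zero (α := 𝕋) (μ := leb) (β := Fin 2 → ℂ)] with t ht _
    simp [ht, quad]
  add_mem' := by
    intro f g hf hg
    refine HasFiniteNorm.of_le ((hf.quad.const_mul 2).add (hg.quad.const_mul 2)) ?_
    filter_upwards [AEEqFun.coeFn_add f g] with t ht hR
    rw [ht]
    exact quad_add_le hR _ _
  smul_mem' := by
    intro c f hf
    refine HasFiniteNorm.of_le (hf.quad.const_mul (‖c‖ ^ 2)) ?_
    filter_upwards [AEEqFun.coeFn_smul c f] with t ht _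
    have : c * f t 1 - R t * (c * f t 0) = c * (f t 1 - R t * f t 0) := by ring
    rw [ht]
    simp only [quad, Pi.smul_apply, smul_eq_mul, this, norm_mul]
    apply le_of_eq
    ring

/-- The space `L^R` of vector functions `f` on the circle with the weighted inner product
`∫ f* [1, R̄; R, 1]⁻¹ g`. -/
def LR : Type := LRSubmodule R

noncomputable instance : AddCommGroup (LR R) := inferInstanceAs (AddCommGroup (LRSubmodule R))

noncomputable instance : Module ℂ (LR R) := inferInstanceAs (Module ℂ (LRSubmodule R))

variable {R}

/-- The vector function underlying an element of `L^R`. -/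
def LR.fn (f : LR R) : 𝕋 →ₘ[leb] (Fin 2 → ℂ) := f.1

theorem LR.fn_mem (f : LR R) : HasFiniteNorm R f.fn := f.2

theorem LR.ext {f g : LR R} (h : f.fn = g.fn) : f = g := Subtype.ext h

theorem LR.fn_add (f g : LR R) : (f + g).fn = f.fn + g.fn := rfl

theorem LR.fn_smul (c : ℂ) (f : LR R) : (c • f).fn = c • f.fn := rfl

variable (R)

/-- The weighted inner product on `L^R`; following Mathlib it is conjugate linear in the first
argument. -/
noncomputable abbrev LR.core : InnerProductSpace.Core ℂ (LR R) where
  inner f g := ∫ t, form (R t) (f.fn t) (g.fn t) ∂leb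
  conj_inner_symm f g := by
    rw [← integral_conj]
    refine integral_congr_ae ?_
    filter_upwards [R.norm_lt_one] with t ht
    exact form_conj ht _ _
  re_inner_nonneg f := by
    have : ∫ t, form (R t) (f.fn t) (f.fn t) ∂leb = ((∫ t, quad (R t) (f.fn t) ∂leb : ℝ) : ℂ) := by
      rw [← integral_complex_ofReal]
      refine integral_congr_ae ?_
      filter_upwards [R.norm_lt_one] with t ht
      exact form_self ht _
    rw [this]
    simp only [RCLike.re_to_complex, Complex.ofReal_re]
    refine integral_nonneg_of_ae ?_
    filter_upwards [R.norm_lt_one] with t ht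
    exact quad_nonneg ht _
  add_left f g h := by
    rw [← integral_add (f.fn_mem.integrable h.fn_mem) (g.fn_mem.integrable h.fn_mem)]
    refine integral_congr_ae ?_
    filter_upwards [AEEqFun.coeFn_add f.fn g.fn] with t ht
    rw [LR.fn_add, ht]
    exact form_add_left _ _ _ _
  smul_left f g c := by
    rw [← integral_const_mul]
    refine integral_congr_ae ?_
    filter_upwards [AEEqFun.coeFn_smul c f.fn] with t ht
    rw [LR.fn_smul, ht]
    exact form_smul_left _ _ _ _
  definite f hf := by
    have h1 : ∫ t, form (R t) (f.fn t) (f.fn t) ∂leb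
        = ((∫ t, quad (R t) (f.fn t) ∂leb : ℝ) : ℂ) := by
      rw [← integral_complex_ofReal]
      refine integral_congr_ae ?_
      filter_upwards [R.norm_lt_one] with t ht
      exact form_self ht _
    have h2 : ∫ t, quad (R t) (f.fn t) ∂leb = 0 := by
      have := h1.symm.trans hf
      exact_mod_cast this
    have h3 : 0 ≤ᵐ[leb] fun t => quad (R t) (f.fn t) := by
      filter_upwards [R.norm_lt_one] with t ht
      exact quad_nonneg ht _
    rw [integral_eq_zero_iff_of_nonneg_ae h3 f.fn_mem.quad] at h2
    refine LR.ext (AEEqFun.ext ?_)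
    filter_upwards [R.norm_lt_one, h2, AEEqFun.coeFn_zero (α := 𝕋) (μ := leb) (β := Fin 2 → ℂ)]
      with t ht h hz
    rw [quad_eq_zero ht h]
    exact hz.symm

noncomputable instance : NormedAddCommGroup (LR R) :=
  @InnerProductSpace.Core.toNormedAddCommGroup ℂ (LR R) _ _ _ (LR.core R)

noncomputable instance : InnerProductSpace ℂ (LR R) :=
  InnerProductSpace.ofCore (LR.core R).toCore

theorem LR.inner_def (f g : LR R) :
    inner ℂ f g = ∫ t, form (R t) (f.fn t) (g.fn t) ∂leb := rfl

/-- The vector function `[1, R̄; R, 1] [g₁; g₂]`. -/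
noncomputable def genFun (g : LTwo × LTwo) : 𝕋 →ₘ[leb] (Fin 2 → ℂ) :=
  AEEqFun.mk (fun t => gram (R t) *ᵥ ![g.1 t, g.2 t]) (by
    have hR : AEMeasurable R.toFun leb := R.aestronglyMeasurable.aemeasurable
    have h1 : AEMeasurable (fun t => g.1 t) leb := (Lp.aestronglyMeasurable g.1).aemeasurable
    have h2 : AEMeasurable (fun t => g.2 t) leb := (Lp.aestronglyMeasurable g.2).aemeasurable
    refine AEMeasurable.aestronglyMeasurable (aemeasurable_pi_iff.mpr fun i => ?_)
    fin_cases i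
    · refine (h1.add ((Complex.continuous_conj.measurable.comp_aemeasurable hR).mul h2)).congr
        (Filter.Eventually.of_forall fun t => ?_)
      simp [gram, Matrix.mulVec, dotProduct, Fin.sum_univ_two]
    · refine ((hR.mul h1).add h2).congr (Filter.Eventually.of_forall fun t => ?_)
      simp [gram, Matrix.mulVec, dotProduct, Fin.sum_univ_two])

theorem quad_gram_le {z : ℂ} (hz : ‖z‖ < 1) (a b : ℂ) :
    quad z (gram z *ᵥ ![a, b]) ≤ 2 * ‖a‖ ^ 2 + 3 * ‖b‖ ^ 2 := by
  have e0 : (gram z *ᵥ ![a, b]) 0 = a + conj z * b := by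
    simp [gram, Matrix.mulVec, dotProduct, Fin.sum_univ_two]
  have e1 : (gram z *ᵥ ![a, b]) 1 = z * a + b := by
    simp [gram, Matrix.mulVec, dotProduct, Fin.sum_univ_two]
  have hp : 0 < 1 - ‖z‖ ^ 2 := by nlinarith [norm_nonneg z]
  have e2 : z * a + b - z * (a + conj z * b) = ((1 - ‖z‖ ^ 2 : ℝ) : ℂ) * b := by
    have := Complex.mul_conj' z
    push_cast
    linear_combination (-b) * this
  have h1 := norm_add_sq_le a (conj z * b)
  rw [norm_mul, RCLike.norm_conj] at h1
  unfold quad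
  rw [e0, e1, e2, norm_mul, Complex.norm_real, Real.norm_of_nonneg hp.le]
  have h2 : ((1 - ‖z‖ ^ 2) * ‖b‖) ^ 2 * (1 - ‖z‖ ^ 2)⁻¹ = (1 - ‖z‖ ^ 2) * ‖b‖ ^ 2 := by
    field_simp
  rw [h2]
  nlinarith [mul_nonneg (sq_nonneg ‖z‖) (sq_nonneg ‖b‖), mul_nonneg hp.le (sq_nonneg ‖b‖)]

theorem coeFn_genFun (g : LTwo × LTwo) :
    genFun R g =ᵐ[leb] fun t => gram (R t) *ᵥ ![g.1 t, g.2 t] :=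
  AEEqFun.coeFn_mk _ _

theorem integrable_sq (g : LTwo) : Integrable (fun t => ‖g t‖ ^ 2) leb := by
  have := (Lp.memLp g).integrable_norm_pow (by norm_num)
  simpa using this

/-- The linear map `[g₁; g₂] ↦ [1, R̄; R, 1] [g₁; g₂]` from `L² ⊕ L²` to `L^R`. -/
noncomputable def gen : (LTwo × LTwo) →ₗ[ℂ] LR R where
  toFun g := ⟨genFun R g, by
    refine HasFiniteNorm.of_le
      (((integrable_sq g.1).const_mul 2).add ((integrable_sq g.2).const_mul 3)) ?_
    filter_upwards [coeFn_genFun R g] with t ht hR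
    rw [ht]
    exact quad_gram_le hR _ _⟩
  map_add' g h := by
    refine LR.ext (AEEqFun.ext ?_)
    change genFun R (g + h) =ᵐ[leb] (genFun R g + genFun R h : 𝕋 →ₘ[leb] (Fin 2 → ℂ))
    filter_upwards [coeFn_genFun R (g + h), AEEqFun.coeFn_add (genFun R g) (genFun R h),
      coeFn_genFun R g, coeFn_genFun R h, Lp.coeFn_add g.1 h.1, Lp.coeFn_add g.2 h.2]
      with t h1 h2 h3 h4 h5 h6
    rw [h1, h2, Pi.add_apply, h3, h4, ← Matrix.mulVec_add, Prod.fst_add, Prod.snd_add, h5, h6]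
    simp
  map_smul' c g := by
    refine LR.ext (AEEqFun.ext ?_)
    change genFun R (c • g) =ᵐ[leb] (c • genFun R g : 𝕋 →ₘ[leb] (Fin 2 → ℂ))
    filter_upwards [coeFn_genFun R (c • g), AEEqFun.coeFn_smul c (genFun R g),
      coeFn_genFun R g, Lp.coeFn_smul c g.1, Lp.coeFn_smul c g.2] with t h1 h2 h3 h5 h6
    rw [h1, h2, Pi.smul_apply, h3, ← Matrix.mulVec_smul, Prod.smul_fst, Prod.smul_snd, h5, h6]
    simp

variable {R}

/-- The vector function `t ^ k • f`. -/
noncomputable def mulFun (k : ℤ) (f : LR R) : 𝕋 →ₘ[leb] (Fin 2 → ℂ) :=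
  AEEqFun.mk (fun t => fourier k t • f.fn t)
    ((fourier k).continuous.aestronglyMeasurable.smul f.fn.aestronglyMeasurable)

theorem coeFn_mulFun (k : ℤ) (f : LR R) : mulFun k f =ᵐ[leb] fun t => fourier k t • f.fn t :=
  AEEqFun.coeFn_mk _ _

theorem norm_fourier_apply (k : ℤ) (t : 𝕋) : ‖fourier k t‖ = 1 := Circle.norm_coe _

theorem quad_smul {z c : ℂ} (hc : ‖c‖ = 1) (u : Fin 2 → ℂ) : quad z (c • u) = quad z u := by
  have : c * u 1 - z * (c * u 0) = c * (u 1 - z * u 0) := by ring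
  simp [quad, this, hc]

variable (R)

/-- Multiplication by `t ^ k` on `L^R`. -/
noncomputable def mulPow (k : ℤ) : LR R →ₗ[ℂ] LR R where
  toFun f := ⟨mulFun k f, by
    refine HasFiniteNorm.of_le f.fn_mem.quad ?_
    filter_upwards [coeFn_mulFun k f] with t ht _
    rw [ht, quad_smul (norm_fourier_apply _ t)]⟩
  map_add' f g := by
    refine LR.ext (AEEqFun.ext ?_)
    change mulFun k (f + g) =ᵐ[leb] (mulFun k f + mulFun k g : 𝕋 →ₘ[leb] (Fin 2 → ℂ))
    filter_upwards [coeFn_mulFun k (f + g), AEEqFun.coeFn_add (mulFun k f) (mulFun k g),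
      coeFn_mulFun k f, coeFn_mulFun k g, AEEqFun.coeFn_add f.fn g.fn] with t h1 h2 h3 h4 h5
    rw [h1, h2, Pi.add_apply, h3, h4, LR.fn_add, h5, Pi.add_apply, smul_add]
  map_smul' c f := by
    refine LR.ext (AEEqFun.ext ?_)
    change mulFun k (c • f) =ᵐ[leb] (c • mulFun k f : 𝕋 →ₘ[leb] (Fin 2 → ℂ))
    filter_upwards [coeFn_mulFun k (c • f), AEEqFun.coeFn_smul c (mulFun k f),
      coeFn_mulFun k f, AEEqFun.coeFn_smul c f.fn] with t h1 h2 h3 h4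
    rw [h1, h2, Pi.smul_apply, h3, LR.fn_smul, h4, Pi.smul_apply, smul_comm]

theorem coeFn_mulPow (k : ℤ) (f : LR R) :
    (mulPow R k f).fn =ᵐ[leb] fun t => fourier k t • f.fn t :=
  coeFn_mulFun k f

theorem mulPow_mulPow (k l : ℤ) (h : k + l = 0) (f : LR R) : mulPow R k (mulPow R l f) = f := by
  refine LR.ext (AEEqFun.ext ?_)
  filter_upwards [coeFn_mulPow R k (mulPow R l f), coeFn_mulPow R l f] with t h1 h2
  rw [h1, h2, smul_smul, ← fourier_add, h, fourier_zero, one_smul]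

/-- The unitary operator `U_R` of multiplication by the independent variable `t` on `L^R`. -/
noncomputable def UR : LR R ≃ₗᵢ[ℂ] LR R where
  toLinearEquiv := LinearEquiv.ofLinearMap (mulPow R 1) (mulPow R (-1))
    (LinearMap.ext fun f => mulPow_mulPow R 1 (-1) (by norm_num) f)
    (LinearMap.ext fun f => mulPow_mulPow R (-1) 1 (by norm_num) f)
  norm_map' f := by
    rw [@norm_eq_sqrt_re_inner ℂ, @norm_eq_sqrt_re_inner ℂ, LR.inner_def, LR.inner_def]
    congr 2
    refine integral_congr_ae ?_
    filter_upwards [R.norm_lt_one, coeFn_mulPow R 1 f] with t ht h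
    change form (R t) ((mulPow R 1 f).fn t) ((mulPow R 1 f).fn t) = _
    rw [h, form_self ht, form_self ht, quad_smul (norm_fourier_apply _ t)]

theorem UR_apply (f : LR R) : (UR R f).fn =ᵐ[leb] fun t => fourier 1 t • f.fn t :=
  coeFn_mulPow R 1 f

/-- The subspace `t ^ n H²₊` of `L²`: the Fourier coefficients with index `< n` vanish. -/
noncomputable def hardyPlus (n : ℤ) : Submodule ℂ LTwo where
  carrier := {g | ∀ k < n, fourierCoeff g k = 0}
  zero_mem' k _ := by rw [← fourierBasis_repr]; simp
  add_mem' := by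
    intro f g hf hg k hk
    have h1 := hf k hk
    have h2 := hg k hk
    rw [← fourierBasis_repr] at h1 h2 ⊢
    rw [map_add, lp.coeFn_add, Pi.add_apply, h1, h2, add_zero]
  smul_mem' := by
    intro c f hf k hk
    have h1 := hf k hk
    rw [← fourierBasis_repr] at h1 ⊢
    rw [map_smul, lp.coeFn_smul, Pi.smul_apply, h1, smul_zero]

/-- The subspace `t̄ ^ m H²₋` of `L²`, where `H²₋ = L² ⊖ H²₊`: the Fourier coefficients with index
`≥ -m` vanish. -/
noncomputable def hardyMinus (m : ℤ) : Submodule ℂ LTwo where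
  carrier := {g | ∀ k, -m ≤ k → fourierCoeff g k = 0}
  zero_mem' k _ := by rw [← fourierBasis_repr]; simp
  add_mem' := by
    intro f g hf hg k hk
    have h1 := hf k hk
    have h2 := hg k hk
    rw [← fourierBasis_repr] at h1 h2 ⊢
    rw [map_add, lp.coeFn_add, Pi.add_apply, h1, h2, add_zero]
  smul_mem' := by
    intro c f hf k hk
    have h1 := hf k hk
    rw [← fourierBasis_repr] at h1 ⊢
    rw [map_smul, lp.coeFn_smul, Pi.smul_apply, h1, smul_zero]

/-- The subspace `Ȟ_{n,m} = Clos [1, R̄; R, 1] [t ^ n H²₊; t̄ ^ m H²₋]` of `L^R`. -/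
noncomputable def H (n m : ℤ) : Submodule ℂ (LR R) :=
  (((hardyPlus n).prod (hardyMinus m)).map (gen R)).topologicalClosure

/-- The defect space `Δ̌_{n,m} = Ȟ_{n,m} ⊖ Ȟ_{n+1,m}`. -/
noncomputable def Defect (n m : ℤ) : Submodule ℂ (LR R) := H R n m ⊓ (H R (n + 1) m)ᗮ

/-- The defect space `Δ̌~_{n,m} = Ȟ_{n,m} ⊖ Ȟ_{n,m+1}`. -/
noncomputable def DefectTilde (n m : ℤ) : Submodule ℂ (LR R) := H R n m ⊓ (H R n (m + 1))ᗮ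

/-- The vector `e_n = [1; R] t ^ n`. -/
noncomputable def eVec (n : ℤ) : LR R := gen R (fourierLp 2 n, 0)

/-- The vector `d_m = [R̄; 1] t̄ ^ (m + 1)`. -/
noncomputable def dVec (m : ℤ) : LR R := gen R (0, fourierLp 2 (-(m + 1)))

/-- `x` is the normalized unit vector `Ǩ_{n,m}` of `Δ̌_{n,m}`. The number `⟨x, e_n⟩` (with Mathlib's
order of arguments `inner ℂ e_n x`) is the value `ǎ_{n,m}(0)` that the normalization makes
positive; `0 < z` in `ℂ` says that `z` is real and positive. -/
def IsK (n m : ℤ) (x : LR R) : Prop :=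
  x ∈ Defect R n m ∧ ‖x‖ = 1 ∧ 0 < inner ℂ (eVec R n) x

/-- `x` is the normalized unit vector `Ǩ~_{n,m}` of `Δ̌~_{n,m}`. -/
def IsKTilde (n m : ℤ) (x : LR R) : Prop :=
  x ∈ DefectTilde R n m ∧ ‖x‖ = 1 ∧ 0 < inner ℂ (dVec R m) x

/-- `A` is a subspace of `B` of codimension one. -/
def IsCodimOne {E : Type*} [AddCommGroup E] [Module ℂ E] (A B : Submodule ℂ E) : Prop :=
  A ≤ B ∧ Module.finrank ℂ (B ⧸ A.submoduleOf B) = 1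

/-- The number `ρ = √(1 - |α|²)`. -/
noncomputable def rho (a : ℂ) : ℝ := √(1 - ‖a‖ ^ 2)

/-- The block `[α, ρ; ρ, -ᾱ]`. -/
noncomputable def block (a : ℂ) : Matrix (Fin 2) (Fin 2) ℂ :=
  !![a, (rho a : ℂ); (rho a : ℂ), -conj a]

/-- The two-sided infinite block diagonal matrix whose diagonal blocks are the `block (α k)`,
placed in rows and columns `k, k + 1`, for the `k` with the same parity as `p`. -/
noncomputable def blockDiag (α : ℤ → ℂ) (p : ℤ) : Matrix ℤ ℤ ℂ := fun i j =>
  if 2 ∣ i - p then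
    if j = i then block (α i) 0 0 else if j = i + 1 then block (α i) 0 1 else 0
  else
    if j = i - 1 then block (α (i - 1)) 1 0 else if j = i then block (α (i - 1)) 1 1 else 0

/-- The (two-sided) CMV matrix with Verblunsky coefficients `α`: the product of the block diagonal
matrix of the odd blocks and the block diagonal matrix of the even blocks. Every sum over `l` has
at most two nonzero terms. -/
noncomputable def cmvMatrix (α : ℤ → ℂ) : Matrix ℤ ℤ ℂ := fun i j =>
  ∑ᶠ l : ℤ, blockDiag α 1 i l * blockDiag α 0 l j

end ScatteringCMV

open ScatteringCMV

namespace ScatteringCMV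

/-! The weight is inverted in the inner product, so pairing with `[1, R̄; R, 1] g` cancels it: the
inner products with `e_k` and `d_k` are plain Fourier coefficients of the two components of a
vector. By Fourier series, `H R n m` is the closed span of the `e_k`, `k ≥ n`, and the `d_k`, `k ≥
m`. Raising an index removes one generator, so the codimension is at most one.

That it is exactly one is Szegő's theorem. The norm of `[1, R̄; R, 1] [p(t); g]` dominates a
weighted `L²` norm of `p` with weight `1 - |R|`. By Jensen's inequality and Jensen's formula, that
norm has a positive lower bound when `p(0) = 1`. Hence `e_0` has a nonzero component `F` orthogonal
to all `d_k` and all `e_k`, `k ≥ 1` (`exists_outer`). Moreover `F` is orthogonal to `t ^ k F` for `k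
≠ 0`, so its pointwise weighted norm is constant: it plays the role of an outer function. Translates
of `F`, and of its image under the conjugation exchanging the `e`'s and the `d`'s, witness that
every step is strict. They also force the intersection of the `H R n n` to be zero, because at
almost every point the two vectors span `ℂ²`.

The rest is Hilbert space geometry. In a square of one-dimensional steps, the two ways down from top
to bottom give two orthonormal bases of a plane. The normalizations make the off-diagonal entries of
the change of basis positive, so unitarity leaves only the form `[α, ρ; ρ, -ᾱ]` (`szego_recursion`).
Multiplication by `t` carries `H R n m` to `H R (n + 1) (m - 1)`, so `α` depends on `n + m` only. It
also carries the staircase basis to the vectors of another staircase. Two applications of the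
recursion lead back, one through the even blocks and one through the odd blocks, which gives the
product `M L`. -/

/-! ### Jensen's formula and Szegő's lower bound for polynomials. -/

theorem volume_circle_eq : (volume : Measure 𝕋) = leb := by
  rw [volume_eq_smul_haarAddCircle]; simp

theorem fourier_one_coe (x : ℝ) : fourier 1 (x : 𝕋) = circleMap 0 1 (2 * Real.pi * x) := by
  rw [fourier_coe_apply, circleMap]
  push_cast
  simp only [zero_add, one_mul, mul_one, div_one]
  congr 1
  ring

theorem measurePreserving_coe :
    MeasurePreserving ((↑) : ℝ → 𝕋) (volume.restrict (Set.Ioc 0 1)) leb := by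
  have h := AddCircle.measurePreserving_mk (1 : ℝ) 0
  rw [volume_circle_eq, zero_add] at h
  exact h

theorem aestronglyMeasurable_log_norm_eval (p : Polynomial ℂ) :
    AEStronglyMeasurable (fun t : 𝕋 => Real.log ‖p.eval (fourier 1 t)‖) leb :=
  (Real.measurable_log.comp
    (p.continuous.comp (fourier 1).continuous).norm.measurable).aestronglyMeasurable

theorem integrable_log_norm_eval (p : Polynomial ℂ) :
    Integrable (fun t : 𝕋 => Real.log ‖p.eval (fourier 1 t)‖) leb := by
  rw [← measurePreserving_coe.integrable_comp (aestronglyMeasurable_log_norm_eval p)]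
  have h := (p.intervalIntegrable_mahlerMeasure).comp_mul_left (c := 2 * Real.pi)
  rw [zero_div, div_self Real.two_pi_pos.ne', intervalIntegrable_iff_integrableOn_Ioc_of_le
    zero_le_one] at h
  refine h.congr (Filter.Eventually.of_forall fun x => ?_)
  simp only [Function.comp, fourier_one_coe]

theorem integral_log_norm_eval (p : Polynomial ℂ) :
    ∫ t : 𝕋, Real.log ‖p.eval (fourier 1 t)‖ ∂leb = p.logMahlerMeasure := by
  rw [Polynomial.logMahlerMeasure_def, Real.circleAverage_def, ← volume_circle_eq,
    ← UnitAddCircle.intervalIntegral_preimage 0]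
  simp only [fourier_one_coe, zero_add]
  rw [intervalIntegral.integral_comp_mul_left
    (fun θ => Real.log ‖p.eval (circleMap 0 1 θ)‖) Real.two_pi_pos.ne']
  simp

/-- The Mahler measure is at least the modulus of the constant term, a form of Jensen's formula. -/
theorem integral_log_norm_eval_nonneg {p : Polynomial ℂ} (hp : p.coeff 0 = 1) :
    0 ≤ ∫ t : 𝕋, Real.log ‖p.eval (fourier 1 t)‖ ∂leb := by
  have h := p.norm_coeff_le_choose_mul_mahlerMeasure 0
  rw [hp] at h
  rw [integral_log_norm_eval, Polynomial.logMahlerMeasure_eq_log_MahlerMeasure]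
  exact Real.log_nonneg (by simpa using h)

/-- Zeros of `p` on the circle must be discarded, because `Real.log 0 = 0` breaks `exp (log x) = x`
there. -/
theorem eval_fourier_ne_zero {p : Polynomial ℂ} (hp : p ≠ 0) :
    ∀ᵐ t ∂leb, p.eval (fourier 1 t) ≠ 0 := by
  have hinj : Function.Injective (fun t : 𝕋 => (fourier 1 t : ℂ)) := fun a b h => by
    simp only [fourier_one] at h
    exact AddCircle.injective_toCircle one_ne_zero (Circle.coe_injective h)
  have hfin : {t : 𝕋 | p.eval (fourier 1 t) = 0}.Finite := by
    refine ((p.roots.toFinset.finite_toSet).preimage hinj.injOn).subset fun t ht => ?_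
    simpa [hp] using ht
  have : NullSingletonClass leb := ⟨fun x => by
    rw [← volume_circle_eq, ← Metric.closedBall_zero, AddCircle.volume_closedBall]; simp⟩
  have := hfin.measure_zero leb
  rw [ae_iff]
  simpa using this

/-- The lower bound in Szegő's theorem: a polynomial with constant term `1` has weighted norm at
least the geometric mean of the weight. -/
theorem exp_integral_log_le {w : 𝕋 → ℝ} (hw : ∀ᵐ t ∂leb, 0 < w t)
    (hlog : Integrable (fun t => Real.log (w t)) leb) {p : Polynomial ℂ} (hp : p.coeff 0 = 1)
    (hint : Integrable (fun t => w t * ‖p.eval (fourier 1 t)‖ ^ 2) leb) :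
    Real.exp (∫ t, Real.log (w t) ∂leb) ≤ ∫ t, w t * ‖p.eval (fourier 1 t)‖ ^ 2 ∂leb := by
  have hp0 : p ≠ 0 := fun h => by simp [h] at hp
  have hlp := integrable_log_norm_eval p
  have heq : (fun t => Real.exp (Real.log (w t) + 2 * Real.log ‖p.eval (fourier 1 t)‖))
      =ᵐ[leb] fun t => w t * ‖p.eval (fourier 1 t)‖ ^ 2 := by
    filter_upwards [hw, eval_fourier_ne_zero hp0] with t h1 h2
    rw [Real.exp_add, Real.exp_log h1, mul_comm 2, Real.exp_mul, Real.exp_log (norm_pos_iff.mpr h2)]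
    norm_num
  -- Jensen's inequality for `exp`, applied to the logarithm of the integrand `w |p|²`.
  have hj := convexOn_exp.map_integral_le (μ := leb)
    (f := fun t => Real.log (w t) + 2 * Real.log ‖p.eval (fourier 1 t)‖)
    Real.continuous_exp.continuousOn isClosed_univ (by simp) (hlog.add (hlp.const_mul 2))
    (hint.congr heq.symm)
  rw [integral_congr_ae heq, integral_add hlog (hlp.const_mul 2), integral_const_mul] at hj
  refine le_trans (Real.exp_le_exp.mpr ?_) hj
  linarith [integral_log_norm_eval_nonneg hp]

/-! ### Uniqueness of Fourier coefficients. -/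

/-- A square integrable function is determined by its Fourier coefficients. -/
theorem ae_eq_zero_of_integral_fourier_eq_zero {h : 𝕋 → ℂ} (hh : MemLp h 2 leb)
    (h0 : ∀ k : ℤ, ∫ t, conj (fourier k t) * h t ∂leb = 0) : h =ᵐ[leb] 0 := by
  have h1 : hh.toLp h = 0 := by
    rw [← (fourierBasis (T := (1 : ℝ))).repr.map_eq_zero_iff]
    ext k
    rw [fourierBasis_repr, fourierCoeff_congr_ae hh.coeFn_toLp, fourierCoeff]
    simpa [← fourier_neg] using h0 k
  have h2 := hh.coeFn_toLp
  rw [h1] at h2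
  exact h2.symm.trans (Lp.coeFn_zero _ _ _)

theorem integral_fourier_span {h : 𝕋 → ℝ} (hi : Integrable h leb)
    (h0 : ∀ k : ℤ, k ≠ 0 → ∫ t, fourier k t * (h t : ℂ) ∂leb = 0) {g : C(𝕋, ℂ)}
    (hg : g ∈ Submodule.span ℂ (Set.range (fourier (T := (1 : ℝ))))) :
    ∫ t, g t * (h t : ℂ) ∂leb = ∫ t, (∫ s, h s ∂leb) • g t ∂leb := by
  have hint : ∀ g : C(𝕋, ℂ), Integrable (fun t => g t * (h t : ℂ)) leb := fun g =>
    hi.ofReal.bdd_mul (c := ‖g‖) g.continuous.aestronglyMeasurable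
      (Filter.Eventually.of_forall fun t => g.norm_coe_le_norm t)
  have hint' : ∀ g : C(𝕋, ℂ), Integrable (fun t => (∫ s, h s ∂leb) • g t) leb := fun g =>
    Continuous.integrable_of_hasCompactSupport (by fun_prop) (HasCompactSupport.of_compactSpace _)
  induction hg using Submodule.span_induction with
  | mem x hx =>
    obtain ⟨k, rfl⟩ := hx
    rw [integral_smul]
    by_cases hk : k = 0
    · subst hk
      simp [integral_complex_ofReal]
    · rw [h0 k hk]
      have := congrFun (fourierCoeff_fourier (T := (1 : ℝ)) k) 0
      simp only [fourierCoeff, neg_zero, fourier_zero, one_smul] at this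
      rw [this, Pi.single_eq_of_ne (Ne.symm hk), smul_zero]
  | zero => simp
  | add x y _ _ hx hy =>
    simp only [ContinuousMap.add_apply, add_mul, smul_add]
    rw [integral_add (hint x) (hint y), integral_add (hint' x) (hint' y), hx, hy]
  | smul a x _ hx =>
    simp only [ContinuousMap.smul_apply, smul_mul_assoc, smul_comm _ a]
    rw [integral_smul, integral_smul, hx]

/-- A nonnegative integrable function all of whose Fourier coefficients except the zeroth one vanish
is constant. -/
theorem ae_eq_const_of_integral_fourier_eq_zero {h : 𝕋 → ℝ} (hi : Integrable h leb)
    (hn : 0 ≤ᵐ[leb] h) (h0 : ∀ k : ℤ, k ≠ 0 → ∫ t, fourier k t * (h t : ℂ) ∂leb = 0) :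
    ∀ᵐ t ∂leb, h t = ∫ s, h s ∂leb := by
  set c := ∫ s, h s ∂leb with hc
  have hc0 : 0 ≤ c := integral_nonneg_of_ae hn
  have hfin : IsFiniteMeasure (leb.withDensity fun t => ENNReal.ofReal (h t)) :=
    isFiniteMeasure_withDensity_ofReal hi.2
  have hfin' : IsFiniteMeasure (leb.withDensity fun _ : 𝕋 => ENNReal.ofReal c) :=
    isFiniteMeasure_withDensity_ofReal (integrable_const c).2
  -- `h` is only integrable, so the `L²` Fourier basis does not apply. Instead the finite measures
  -- with densities `h` and `c` are compared: they agree on trigonometric polynomials, a star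
  -- subalgebra that separates points.
  have hm : leb.withDensity (fun t => ENNReal.ofReal (h t))
      = leb.withDensity (fun _ => ENNReal.ofReal c) := by
    refine ext_of_forall_mem_subalgebra_integral_eq_of_polish (𝕜 := ℂ)
      (A := (fourierSubalgebra (T := (1 : ℝ))).comap
        (BoundedContinuousFunction.toContinuousMapStarₐ ℂ)) ?_ ?_
    · intro x y hxy
      obtain ⟨_, ⟨f, hf, rfl⟩, hne⟩ := fourierSubalgebra_separatesPoints (T := (1 : ℝ)) hxy
      exact ⟨f, ⟨f, ⟨BoundedContinuousFunction.mkOfCompact f, hf, rfl⟩, rfl⟩, hne⟩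
    · intro g hg
      have hg' : g.toContinuousMap ∈ Submodule.span ℂ (Set.range (fourier (T := (1 : ℝ)))) := by
        rw [← fourierSubalgebra_coe]; exact hg
      rw [integral_withDensity_eq_integral_toReal_smul₀ hi.1.aemeasurable.ennreal_ofReal
        (Filter.Eventually.of_forall fun _ => ENNReal.ofReal_lt_top),
        integral_withDensity_eq_integral_toReal_smul₀ aemeasurable_const
        (Filter.Eventually.of_forall fun _ => ENNReal.ofReal_lt_top),
        ENNReal.toReal_ofReal hc0]
      refine Eq.trans (integral_congr_ae ?_) (integral_fourier_span hi h0 hg')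
      filter_upwards [hn] with t ht
      rw [ENNReal.toReal_ofReal ht, Complex.real_smul, mul_comm]
      rfl
  have hcong := (withDensity_eq_iff (hi.1.aemeasurable.ennreal_ofReal) aemeasurable_const
    (by
      rw [← ofReal_integral_eq_lintegral_ofReal hi hn]; exact ENNReal.ofReal_ne_top)).mp hm
  filter_upwards [hcong, hn] with t h1 h2
  exact (ENNReal.ofReal_eq_ofReal_iff h2 hc0).mp h1

/-! ### Pointwise estimates for the weight matrix. -/

theorem one_sub_sq_pos {z : ℂ} (hz : ‖z‖ < 1) : 0 < 1 - ‖z‖ ^ 2 := by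
  nlinarith [norm_nonneg z]

/-- The Hermitian matrix `gram z` cancels the inverse in `form`. -/
theorem form_gram_left {z : ℂ} (hz : ‖z‖ < 1) (a b : ℂ) (v : Fin 2 → ℂ) :
    form z (gram z *ᵥ ![a, b]) v = conj a * v 0 + conj b * v 1 := by
  have e0 : (gram z *ᵥ ![a, b]) 0 = a + conj z * b := by
    simp [gram, Matrix.mulVec, dotProduct, Fin.sum_univ_two]
  have e1 : (gram z *ᵥ ![a, b]) 1 = z * a + b := by
    simp [gram, Matrix.mulVec, dotProduct, Fin.sum_univ_two]
  have hne := one_sub_ne hz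
  have h' : (((1 - ‖z‖ ^ 2)⁻¹ : ℝ) : ℂ) = (1 - conj z * z)⁻¹ := by
    rw [Complex.conj_mul']; push_cast; ring
  rw [form_eq hz, e0, e1, h']
  simp only [map_add, map_sub, map_mul, Complex.conj_conj]
  linear_combination (conj b * (v 1 - z * v 0)) * inv_mul_cancel₀ hne

theorem norm_form_sq_le {z : ℂ} (hz : ‖z‖ < 1) (u v : Fin 2 → ℂ) :
    ‖form z u v‖ ^ 2 ≤ quad z u * quad z v := by
  have h0 := inv_nonneg_of_lt hz
  set d := (1 - ‖z‖ ^ 2)⁻¹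
  have h1 : ‖form z u v‖ ≤ ‖u 0‖ * ‖v 0‖ + ‖u 1 - z * u 0‖ * ‖v 1 - z * v 0‖ * d := by
    rw [form_eq hz]
    refine (norm_add_le _ _).trans ?_
    rw [norm_mul, norm_mul, norm_mul, RCLike.norm_conj, RCLike.norm_conj, Complex.norm_real,
      Real.norm_of_nonneg h0.le]
  refine (pow_le_pow_left₀ (norm_nonneg _) h1 2).trans ?_
  unfold quad
  nlinarith [mul_nonneg h0.le (sq_nonneg (‖u 0‖ * ‖v 1 - z * v 0‖ - ‖u 1 - z * u 0‖ * ‖v 0‖))]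

/-- The right-hand side equals `|a + z̄ b|² + (1 - |z|²) |b|²`. Minimizing over `b` would give the
better factor `1 - |z|²`; the factor `1 - |z|` suffices and matches the hypothesis on `log (1 -
|R|)`. -/
theorem le_quad_gram {z : ℂ} (hz : ‖z‖ < 1) (a b : ℂ) :
    (1 - ‖z‖) * ‖a‖ ^ 2 ≤ quad z (gram z *ᵥ ![a, b]) := by
  have e0 : (gram z *ᵥ ![a, b]) 0 = a + conj z * b := by
    simp [gram, Matrix.mulVec, dotProduct, Fin.sum_univ_two]
  have e1 : (gram z *ᵥ ![a, b]) 1 = z * a + b := by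
    simp [gram, Matrix.mulVec, dotProduct, Fin.sum_univ_two]
  have hp := one_sub_sq_pos hz
  have e2 : z * a + b - z * (a + conj z * b) = ((1 - ‖z‖ ^ 2 : ℝ) : ℂ) * b := by
    have := Complex.mul_conj' z
    push_cast
    linear_combination (-b) * this
  have h2 : ((1 - ‖z‖ ^ 2) * ‖b‖) ^ 2 * (1 - ‖z‖ ^ 2)⁻¹ = (1 - ‖z‖ ^ 2) * ‖b‖ ^ 2 := by
    field_simp
  have h3 : ‖a‖ ≤ ‖a + conj z * b‖ + ‖z‖ * ‖b‖ := by
    have := norm_sub_le (a + conj z * b) (conj z * b)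
    rwa [add_sub_cancel_right, norm_mul, RCLike.norm_conj] at this
  unfold quad
  rw [e0, e1, e2, norm_mul, Complex.norm_real, Real.norm_of_nonneg hp.le, h2]
  set x := ‖a + conj z * b‖
  set y := ‖b‖
  set r := ‖z‖
  have hr : 0 ≤ r := norm_nonneg _
  have h4 : (1 - r) * ‖a‖ ^ 2 ≤ (1 - r) * (x + r * y) ^ 2 :=
    mul_le_mul_of_nonneg_left (pow_le_pow_left₀ (norm_nonneg _) h3 2) (by linarith)
  -- The difference `x² + (1 - r²) y² - (1 - r) (x + r y)²` equals `r (x - (1 - r) y)² + (1 - r)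
  -- y²`.
  nlinarith [mul_nonneg hr (sq_nonneg (x - (1 - r) * y)), sq_nonneg y, mul_nonneg hr (sq_nonneg y),
    mul_nonneg (mul_nonneg hr hr) (sq_nonneg y), mul_nonneg (sub_nonneg.mpr hz.le) (sq_nonneg y)]

/-! ### Norms and Fourier coefficients in `L^R`. -/

variable {R : SzegoFunction}

theorem LR.inner_self_eq (f : LR R) : inner ℂ f f = ((∫ t, quad (R t) (f.fn t) ∂leb : ℝ) : ℂ) := by
  rw [LR.inner_def, ← integral_complex_ofReal]
  refine integral_congr_ae ?_
  filter_upwards [R.norm_lt_one] with t ht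
  exact form_self ht _

theorem LR.norm_sq_eq (f : LR R) : ‖f‖ ^ 2 = ∫ t, quad (R t) (f.fn t) ∂leb := by
  have := inner_self_eq_norm_sq_to_K (𝕜 := ℂ) f
  rw [LR.inner_self_eq, ← RCLike.ofReal_pow] at this
  exact Complex.ofReal_injective this.symm

theorem quad_ae_nonneg (f : LR R) : 0 ≤ᵐ[leb] fun t => quad (R t) (f.fn t) := by
  filter_upwards [R.norm_lt_one] with t ht using quad_nonneg ht _

theorem LTwo.norm_sq_eq (g : LTwo) : ‖g‖ ^ 2 = ∫ t, ‖g t‖ ^ 2 ∂leb := by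
  have := inner_self_eq_norm_sq_to_K (𝕜 := ℂ) g
  rw [L2.inner_def] at this
  have h2 : ∀ t, inner ℂ (g t) (g t) = ((‖g t‖ ^ 2 : ℝ) : ℂ) := fun t => by
    rw [inner_self_eq_norm_sq_to_K]; push_cast; rfl
  simp only [h2] at this
  rw [integral_complex_ofReal, ← RCLike.ofReal_pow] at this
  exact Complex.ofReal_injective this.symm

theorem norm_gen_le (g : LTwo × LTwo) : ‖gen R g‖ ≤ 3 * ‖g‖ := by
  have h : ‖gen R g‖ ^ 2 ≤ 2 * ‖g.1‖ ^ 2 + 3 * ‖g.2‖ ^ 2 := by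
    rw [LR.norm_sq_eq, LTwo.norm_sq_eq, LTwo.norm_sq_eq, ← integral_const_mul,
      ← integral_const_mul, ← integral_add ((integrable_sq _).const_mul _)
        ((integrable_sq _).const_mul _)]
    refine integral_mono_ae (gen R g).fn_mem.quad
      (((integrable_sq _).const_mul _).add ((integrable_sq _).const_mul _)) ?_
    filter_upwards [R.norm_lt_one, coeFn_genFun R g] with t ht h
    change quad (R t) (genFun R g t) ≤ _
    rw [h]
    exact quad_gram_le ht _ _
  have h1 := norm_fst_le g
  have h2 := norm_snd_le g
  refine le_of_sq_le_sq ?_ (by positivity)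
  nlinarith [norm_nonneg g.1, norm_nonneg g.2]

variable (R) in
/-- `gen` as a continuous linear map. -/
noncomputable def genL : (LTwo × LTwo) →L[ℂ] LR R := (gen R).mkContinuous 3 norm_gen_le

theorem genL_apply (g : LTwo × LTwo) : genL R g = gen R g := rfl

theorem inner_gen (g : LTwo × LTwo) (f : LR R) :
    inner ℂ (gen R g) f = ∫ t, (conj (g.1 t) * f.fn t 0 + conj (g.2 t) * f.fn t 1) ∂leb := by
  rw [LR.inner_def]
  refine integral_congr_ae ?_
  filter_upwards [R.norm_lt_one, coeFn_genFun R g] with t ht h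
  change form (R t) (genFun R g t) (f.fn t) = _
  rw [h, form_gram_left ht]

theorem inner_eVec (k : ℤ) (f : LR R) :
    inner ℂ (eVec R k) f = ∫ t, conj (fourier k t) * f.fn t 0 ∂leb := by
  rw [eVec, inner_gen]
  refine integral_congr_ae ?_
  filter_upwards [coeFn_fourierLp (T := (1 : ℝ)) 2 k, Lp.coeFn_zero ℂ 2 leb] with t h1 h2
  simp only [h1, h2]
  simp

theorem inner_dVec (k : ℤ) (f : LR R) :
    inner ℂ (dVec R k) f = ∫ t, conj (fourier (-(k + 1)) t) * f.fn t 1 ∂leb := by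
  rw [dVec, inner_gen]
  refine integral_congr_ae ?_
  filter_upwards [coeFn_fourierLp (T := (1 : ℝ)) 2 (-(k + 1)), Lp.coeFn_zero ℂ 2 leb] with t h1 h2
  simp only [h1, h2]
  simp

/-- The eigenvalues of `gram z` are `1 ± |z| ≤ 2`, so its inverse is bounded below by `1/2`. Hence
the components of a vector of `L^R` lie in `L²`. -/
theorem norm_sq_le_quad {z : ℂ} (hz : ‖z‖ < 1) (u : Fin 2 → ℂ) (i : Fin 2) :
    ‖u i‖ ^ 2 ≤ 2 * quad z u := by
  have h0 := one_sub_sq_pos hz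
  have h1 : 1 ≤ (1 - ‖z‖ ^ 2)⁻¹ := (one_le_inv₀ h0).mpr (by nlinarith [sq_nonneg ‖z‖])
  have h2 : ‖u 1 - z * u 0‖ ^ 2 ≤ ‖u 1 - z * u 0‖ ^ 2 * (1 - ‖z‖ ^ 2)⁻¹ :=
    le_mul_of_one_le_right (sq_nonneg _) h1
  have h3 := norm_add_sq_le (u 1 - z * u 0) (z * u 0)
  rw [sub_add_cancel, norm_mul] at h3
  unfold quad
  fin_cases i
  · simp only [Fin.zero_eta]
    nlinarith [sq_nonneg ‖u 0‖, sq_nonneg ‖u 1 - z * u 0‖]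
  · simp only [Fin.mk_one]
    nlinarith [mul_nonneg h0.le (sq_nonneg ‖u 0‖)]

theorem LR.aestronglyMeasurable_apply (f : LR R) (i : Fin 2) :
    AEStronglyMeasurable (fun t => f.fn t i) leb :=
  (continuous_apply i).comp_aestronglyMeasurable f.fn.aestronglyMeasurable

theorem LR.memLp_apply (f : LR R) (i : Fin 2) : MemLp (fun t => f.fn t i) 2 leb := by
  rw [memLp_two_iff_integrable_sq_norm (f.aestronglyMeasurable_apply i)]
  refine (f.fn_mem.quad.const_mul 2).mono' ((f.aestronglyMeasurable_apply i).norm.pow 2) ?_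
  filter_upwards [R.norm_lt_one] with t ht
  rw [Real.norm_of_nonneg (sq_nonneg _)]
  exact norm_sq_le_quad ht _ _

theorem fn_zero_eq_zero {f : LR R} (h : ∀ k, inner ℂ (eVec R k) f = 0) :
    ∀ᵐ t ∂leb, f.fn t 0 = 0 :=
  ae_eq_zero_of_integral_fourier_eq_zero (f.memLp_apply 0) fun k => by rw [← inner_eVec, h]

theorem fn_one_eq_zero {f : LR R} (h : ∀ k, inner ℂ (dVec R k) f = 0) :
    ∀ᵐ t ∂leb, f.fn t 1 = 0 :=
  ae_eq_zero_of_integral_fourier_eq_zero (f.memLp_apply 1) fun k => by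
    have := inner_dVec (-k - 1) f
    rwa [h, sub_add_cancel, neg_neg, eq_comm] at this

theorem LR.eq_zero_of_ae {f : LR R} (h0 : ∀ᵐ t ∂leb, f.fn t 0 = 0) (h1 : ∀ᵐ t ∂leb, f.fn t 1 = 0) :
    f = 0 := by
  refine LR.ext (AEEqFun.ext ?_)
  filter_upwards [h0, h1, AEEqFun.coeFn_zero (α := 𝕋) (μ := leb) (β := Fin 2 → ℂ)] with t a b c
  refine Eq.trans ?_ c.symm
  funext i
  fin_cases i
  · exact a
  · exact b

/-! ### Generators of `H R n m` and the shift. -/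

theorem UR_gen_fourierLp (a b : ℂ) (k l : ℤ) :
    UR R (gen R (a • fourierLp 2 k, b • fourierLp 2 l)) =
      gen R (a • fourierLp 2 (k + 1), b • fourierLp 2 (l + 1)) := by
  refine LR.ext (AEEqFun.ext ?_)
  filter_upwards [UR_apply R (gen R (a • fourierLp 2 k, b • fourierLp 2 l)),
    coeFn_genFun R (a • fourierLp 2 k, b • fourierLp 2 l),
    coeFn_genFun R (a • fourierLp 2 (k + 1), b • fourierLp 2 (l + 1)),
    Lp.coeFn_smul a (fourierLp (T := (1 : ℝ)) 2 k), Lp.coeFn_smul b (fourierLp (T := (1 : ℝ)) 2 l),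
    Lp.coeFn_smul a (fourierLp (T := (1 : ℝ)) 2 (k + 1)),
    Lp.coeFn_smul b (fourierLp (T := (1 : ℝ)) 2 (l + 1)),
    coeFn_fourierLp (T := (1 : ℝ)) 2 k, coeFn_fourierLp (T := (1 : ℝ)) 2 l,
    coeFn_fourierLp (T := (1 : ℝ)) 2 (k + 1), coeFn_fourierLp (T := (1 : ℝ)) 2 (l + 1)]
    with t h1 h2 h3 h4 h5 h6 h7 h8 h9 h10 h11
  rw [h1]
  change fourier 1 t • genFun R _ t = genFun R _ t
  rw [h2, h3, h4, h5, h6, h7, ← Matrix.mulVec_smul]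
  congr 1
  funext i
  fin_cases i
  · simp only [Pi.smul_apply, h8, h10, smul_eq_mul, fourier_add, Fin.zero_eta,
      Matrix.cons_val_zero]
    ring
  · simp only [Pi.smul_apply, h9, h11, smul_eq_mul, fourier_add, Fin.mk_one, Matrix.cons_val_one,
      Matrix.cons_val_fin_one]
    ring

theorem UR_eVec (k : ℤ) : UR R (eVec R k) = eVec R (k + 1) := by
  simpa [eVec] using UR_gen_fourierLp (R := R) 1 0 k 0

theorem UR_dVec (k : ℤ) : UR R (dVec R k) = dVec R (k - 1) := by
  have := UR_gen_fourierLp (R := R) 0 1 0 (-(k + 1))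
  rw [show -(k + 1) + 1 = -(k - 1 + 1) by ring] at this
  simpa [dVec] using this

variable (R) in
/-- The vectors that span `H R n m`. -/
def genSet (n m : ℤ) : Set (LR R) := eVec R '' Set.Ici n ∪ dVec R '' Set.Ici m

theorem H_eq (n m : ℤ) : H R n m = (Submodule.span ℂ (genSet R n m)).topologicalClosure := by
  apply le_antisymm
  · refine Submodule.topologicalClosure_minimal _ ?_ (Submodule.isClosed_topologicalClosure _)
    rintro _ ⟨⟨g₁, g₂⟩, ⟨h1, h2⟩, rfl⟩
    have key : ∀ (L : LTwo →L[ℂ] LR R) (g : LTwo), (∀ k, fourierCoeff g k ≠ 0 →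
        L (fourierLp 2 k) ∈ Submodule.span ℂ (genSet R n m)) →
        L g ∈ (Submodule.span ℂ (genSet R n m)).topologicalClosure := by
      intro L g hL
      -- A continuous linear map sends the Fourier series of `g` to a convergent series, so only the
      -- frequencies present in `g` matter.
      have hs := (hasSum_fourier_series_L2 g).mapL L
      refine (Submodule.isClosed_topologicalClosure _).mem_of_tendsto hs
        (Filter.Eventually.of_forall fun s => Submodule.sum_mem _ fun k _ => ?_)
      rw [map_smul]
      by_cases hk : fourierCoeff g k = 0
      · rw [hk, zero_smul]; exact Submodule.zero_mem _
      · exact Submodule.le_topologicalClosure _ (Submodule.smul_mem _ _ (hL k hk))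
    have e : gen R (g₁, g₂) = (genL R ∘L ContinuousLinearMap.inl ℂ LTwo LTwo) g₁ +
        (genL R ∘L ContinuousLinearMap.inr ℂ LTwo LTwo) g₂ := by
      simp [genL_apply, ← map_add]
    rw [e]
    refine Submodule.add_mem _ (key _ _ fun k hk => ?_) (key _ _ fun k hk => ?_)
    · refine Submodule.subset_span (Or.inl ⟨k, ?_, rfl⟩)
      by_contra hlt
      exact hk (h1 k (not_le.mp hlt))
    -- The vector `d_j` carries the frequency `-(j + 1)`, so frequency `k` belongs to `j = -k - 1`;
    -- the condition `k < -m` becomes `j ≥ m`.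
    · refine Submodule.subset_span (Or.inr ⟨-k - 1, ?_, ?_⟩)
      · by_contra hlt
        simp only [Set.mem_Ici] at hlt
        exact hk (h2 k (by omega))
      · simp [dVec, genL_apply]
  · refine Submodule.topologicalClosure_mono (Submodule.span_le.mpr ?_)
    have hc : ∀ k j : ℤ, j ≠ k → fourierCoeff (fourierLp (T := (1 : ℝ)) 2 k) j = 0 := by
      intro k j hjk
      rw [fourierCoeff_congr_ae (coeFn_fourierLp 2 k), fourierCoeff_fourier,
        Pi.single_eq_of_ne hjk]
    rintro _ (⟨k, hk, rfl⟩ | ⟨k, hk, rfl⟩)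
    · refine ⟨(fourierLp 2 k, 0), ⟨fun j hj => hc _ _ ?_, Submodule.zero_mem _⟩, rfl⟩
      simp only [Set.mem_Ici] at hk
      omega
    · refine ⟨(0, fourierLp 2 (-(k + 1))), ⟨Submodule.zero_mem _, fun j hj => hc _ _ ?_⟩, rfl⟩
      simp only [Set.mem_Ici] at hk
      omega

/-! ### Completeness of `L^R`. -/

theorem aestronglyMeasurable_sqrt_one_sub_sq :
    AEStronglyMeasurable (fun t => ((√(1 - ‖R t‖ ^ 2) : ℝ) : ℂ)) leb :=
  Complex.continuous_ofReal.comp_aestronglyMeasurable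
    (Real.continuous_sqrt.comp_aestronglyMeasurable
      (aestronglyMeasurable_const.sub (R.aestronglyMeasurable.norm.pow 2)))

variable (R) in
/-- The vector function `[g₁; R g₁ + √(1 - |R|²) g₂]`. -/
noncomputable def triangularFun (g : LTwo × LTwo) : 𝕋 →ₘ[leb] (Fin 2 → ℂ) :=
  AEEqFun.mk (fun t => ![g.1 t, R t * g.1 t + ((√(1 - ‖R t‖ ^ 2) : ℝ) : ℂ) * g.2 t]) (by
    have h1 := Lp.aestronglyMeasurable g.1
    have h2 := Lp.aestronglyMeasurable g.2
    refine (aemeasurable_pi_iff.mpr fun i => ?_).aestronglyMeasurable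
    fin_cases i
    · exact h1.aemeasurable
    · exact ((R.aestronglyMeasurable.mul h1).add
        (aestronglyMeasurable_sqrt_one_sub_sq.mul h2)).aemeasurable)

theorem coeFn_triangularFun (g : LTwo × LTwo) : triangularFun R g =ᵐ[leb]
    fun t => ![g.1 t, R t * g.1 t + ((√(1 - ‖R t‖ ^ 2) : ℝ) : ℂ) * g.2 t] :=
  AEEqFun.coeFn_mk _ _

/-- This triangular matrix is the Cholesky factor of `gram z`. It identifies `L^R` with `L² ⊕ L²`,
which transports completeness. -/
theorem quad_triangular {z : ℂ} (hz : ‖z‖ < 1) (a b : ℂ) :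
    quad z ![a, z * a + ((√(1 - ‖z‖ ^ 2) : ℝ) : ℂ) * b] = ‖a‖ ^ 2 + ‖b‖ ^ 2 := by
  have h := one_sub_sq_pos hz
  simp only [quad, Matrix.cons_val_zero, Matrix.cons_val_one, Matrix.cons_val_fin_one,
    add_sub_cancel_left, norm_mul, Complex.norm_real, mul_pow, Real.norm_eq_abs, sq_abs,
    Real.sq_sqrt h.le]
  field_simp

variable (R) in
/-- The map `[g₁; g₂] ↦ [g₁; R g₁ + √(1 - |R|²) g₂]` from `L² ⊕ L²` onto `L^R`. -/
noncomputable def triangular : (LTwo × LTwo) →ₗ[ℂ] LR R where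
  toFun g := ⟨triangularFun R g, by
    refine HasFiniteNorm.of_le ((integrable_sq g.1).add (integrable_sq g.2)) ?_
    filter_upwards [coeFn_triangularFun (R := R) g] with t ht hR
    rw [ht]
    exact (quad_triangular hR _ _).le⟩
  map_add' g h := by
    refine LR.ext (AEEqFun.ext ?_)
    change triangularFun R (g + h) =ᵐ[leb]
      (triangularFun R g + triangularFun R h : 𝕋 →ₘ[leb] (Fin 2 → ℂ))
    filter_upwards [coeFn_triangularFun (R := R) (g + h),
      AEEqFun.coeFn_add (triangularFun R g) (triangularFun R h),
      coeFn_triangularFun (R := R) g, coeFn_triangularFun (R := R) h, Lp.coeFn_add g.1 h.1,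
      Lp.coeFn_add g.2 h.2] with t h1 h2 h3 h4 h5 h6
    rw [h1, h2, Pi.add_apply, h3, h4, Prod.fst_add, Prod.snd_add, h5, h6]
    funext i
    fin_cases i
    · simp
    · simp; ring
  map_smul' c g := by
    refine LR.ext (AEEqFun.ext ?_)
    change triangularFun R (c • g) =ᵐ[leb] (c • triangularFun R g : 𝕋 →ₘ[leb] (Fin 2 → ℂ))
    filter_upwards [coeFn_triangularFun (R := R) (c • g), AEEqFun.coeFn_smul c (triangularFun R g),
      coeFn_triangularFun (R := R) g, Lp.coeFn_smul c g.1, Lp.coeFn_smul c g.2]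
      with t h1 h2 h3 h5 h6
    rw [h1, h2, Pi.smul_apply, h3, Prod.smul_fst, Prod.smul_snd, h5, h6]
    funext i
    fin_cases i
    · simp
    · simp; ring

theorem norm_triangular_sq (g : LTwo × LTwo) :
    ‖triangular R g‖ ^ 2 = ‖g.1‖ ^ 2 + ‖g.2‖ ^ 2 := by
  rw [LR.norm_sq_eq, LTwo.norm_sq_eq, LTwo.norm_sq_eq,
    ← integral_add (integrable_sq _) (integrable_sq _)]
  refine integral_congr_ae ?_
  filter_upwards [R.norm_lt_one, coeFn_triangularFun (R := R) g] with t ht h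
  change quad (R t) (triangularFun R g t) = _
  rw [h, quad_triangular ht]

theorem triangular_surjective : Function.Surjective (triangular R) := by
  intro f
  have hm := aestronglyMeasurable_sqrt_one_sub_sq (R := R)
  have h2 : MemLp (fun t => (f.fn t 1 - R t * f.fn t 0) *
      ((√(1 - ‖R t‖ ^ 2) : ℝ) : ℂ)⁻¹) 2 leb := by
    have hmeas : AEStronglyMeasurable (fun t => (f.fn t 1 - R t * f.fn t 0) *
        ((√(1 - ‖R t‖ ^ 2) : ℝ) : ℂ)⁻¹) leb :=
      ((f.aestronglyMeasurable_apply 1).sub (R.aestronglyMeasurable.mul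
        (f.aestronglyMeasurable_apply 0))).mul hm.aemeasurable.inv.aestronglyMeasurable
    rw [memLp_two_iff_integrable_sq_norm hmeas]
    refine f.fn_mem.quad.mono' (hmeas.norm.pow 2) ?_
    filter_upwards [R.norm_lt_one] with t ht
    rw [Real.norm_of_nonneg (sq_nonneg _), norm_mul, norm_inv, Complex.norm_real, mul_pow, inv_pow,
      Real.norm_eq_abs, sq_abs, Real.sq_sqrt (one_sub_sq_pos ht).le]
    exact le_add_of_nonneg_left (sq_nonneg _)
  refine ⟨((f.memLp_apply 0).toLp _, h2.toLp _), LR.ext (AEEqFun.ext ?_)⟩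
  change triangularFun R _ =ᵐ[leb] _
  filter_upwards [coeFn_triangularFun (R := R) ((f.memLp_apply 0).toLp _, h2.toLp _),
    (f.memLp_apply 0).coeFn_toLp, h2.coeFn_toLp, R.norm_lt_one] with t e1 e2 e3 ht
  rw [e1, e2, e3]
  have hne : ((√(1 - ‖R t‖ ^ 2) : ℝ) : ℂ) ≠ 0 :=
    Complex.ofReal_ne_zero.mpr (Real.sqrt_ne_zero'.mpr (one_sub_sq_pos ht))
  funext i
  fin_cases i
  · simp
  · simp only [Fin.mk_one, Matrix.cons_val_one, Matrix.cons_val_fin_one]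
    field_simp
    ring

instance : CompleteSpace (LR R) := by
  -- The product `LTwo × LTwo` carries the maximum norm, so `triangular` is bi-Lipschitz here rather
  -- than isometric.
  have hb : ∀ g, ‖triangular R g‖ ≤ 2 * ‖g‖ := fun g => by
    refine le_of_sq_le_sq ?_ (by positivity)
    rw [norm_triangular_sq]
    nlinarith [norm_fst_le g, norm_snd_le g, norm_nonneg g.1, norm_nonneg g.2]
  have ha : ∀ g, ‖g‖ ≤ (1 : NNReal) * ‖triangular R g‖ := fun g => by
    rw [NNReal.coe_one, one_mul, Prod.norm_def]
    refine max_le ?_ ?_ <;> refine le_of_sq_le_sq ?_ (norm_nonneg _) <;> rw [norm_triangular_sq] <;>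
      nlinarith [sq_nonneg ‖g.1‖, sq_nonneg ‖g.2‖]
  let T := (triangular R).mkContinuous 2 hb
  have hu : IsUniformInducing T :=
    (AddMonoidHomClass.antilipschitz_of_bound T ha).isUniformInducing T.uniformContinuous
  exact (hu.completeSpace_congr triangular_surjective).mp inferInstance

instance (n m : ℤ) : CompleteSpace (H R n m) :=
  (Submodule.isClosed_topologicalClosure _).completeSpace_coe

/-! ### Orthogonality to `H R n m` and multiplication by powers of `t`. -/

theorem mem_orthogonal_H {n m : ℤ} {f : LR R} (h1 : ∀ k, n ≤ k → inner ℂ (eVec R k) f = 0)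
    (h2 : ∀ k, m ≤ k → inner ℂ (dVec R k) f = 0) : f ∈ (H R n m)ᗮ := by
  rw [H_eq, Submodule.orthogonal_closure, Submodule.mem_orthogonal]
  intro u hu
  induction hu using Submodule.span_induction with
  | mem x hx =>
    rcases hx with ⟨k, hk, rfl⟩ | ⟨k, hk, rfl⟩
    · exact h1 k hk
    · exact h2 k hk
  | zero => exact inner_zero_left _
  | add x y _ _ hx hy => rw [inner_add_left, hx, hy, add_zero]
  | smul a x _ hx => rw [inner_smul_left, hx, mul_zero]

theorem eVec_mem_H {n m k : ℤ} (h : n ≤ k) : eVec R k ∈ H R n m := by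
  rw [H_eq]
  exact Submodule.le_topologicalClosure _ (Submodule.subset_span (Or.inl ⟨k, h, rfl⟩))

theorem dVec_mem_H {n m k : ℤ} (h : m ≤ k) : dVec R k ∈ H R n m := by
  rw [H_eq]
  exact Submodule.le_topologicalClosure _ (Submodule.subset_span (Or.inr ⟨k, h, rfl⟩))

theorem inner_mulPow_left (k : ℤ) (f g : LR R) : inner ℂ (mulPow R k f) g =
    ∫ t, conj (fourier k t) * form (R t) (f.fn t) (g.fn t) ∂leb := by
  rw [LR.inner_def]
  refine integral_congr_ae ?_
  filter_upwards [coeFn_mulPow R k f] with t h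
  rw [h, form_smul_left]

theorem inner_eVec_mulPow (k j : ℤ) (f : LR R) :
    inner ℂ (eVec R k) (mulPow R j f) = inner ℂ (eVec R (k - j)) f := by
  rw [inner_eVec, inner_eVec]
  refine integral_congr_ae ?_
  filter_upwards [coeFn_mulPow R j f] with t h
  rw [h, ← fourier_neg, ← fourier_neg, Pi.smul_apply, smul_eq_mul, ← mul_assoc, ← fourier_add]
  congr 3
  ring

theorem inner_dVec_mulPow (k j : ℤ) (f : LR R) :
    inner ℂ (dVec R k) (mulPow R j f) = inner ℂ (dVec R (k + j)) f := by
  rw [inner_dVec, inner_dVec]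
  refine integral_congr_ae ?_
  filter_upwards [coeFn_mulPow R j f] with t h
  rw [h, ← fourier_neg, ← fourier_neg, Pi.smul_apply, smul_eq_mul, ← mul_assoc, ← fourier_add]
  congr 3
  ring

/-! ### Szegő's theorem in `L^R` and the outer vector. -/

/-- The trigonometric polynomial `p (t)` as an element of `L²`. -/
noncomputable def polyL : Polynomial ℂ →ₗ[ℂ] LTwo :=
  (ContinuousMap.toLp 2 leb ℂ).toLinearMap ∘ₗ (Polynomial.aeval (fourier 1 : C(𝕋, ℂ))).toLinearMap

theorem coeFn_polyL (p : Polynomial ℂ) : polyL p =ᵐ[leb] fun t => p.eval (fourier 1 t) := by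
  filter_upwards [ContinuousMap.coeFn_toLp (p := 2) (𝕜 := ℂ) leb
    (Polynomial.aeval (fourier 1 : C(𝕋, ℂ)) p)] with t h
  refine h.trans ?_
  rw [Polynomial.aeval_continuousMap_apply]

theorem polyL_X_pow (k : ℕ) : polyL (Polynomial.X ^ k) = fourierLp 2 k := by
  have : (fourier 1 : C(𝕋, ℂ)) ^ k = fourier k := by
    induction k with
    | zero => ext t; simp
    | succ k ih => ext t; rw [pow_succ, ih, Nat.cast_succ, fourier_add]; rfl
  simp [polyL, this, fourierLp]

variable (R) in
/-- The span of the vectors `e_k`, `k ≥ 1`, and `d_k`, `k ∈ ℤ`. -/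
noncomputable def pastSpan : Submodule ℂ (LR R) :=
  Submodule.span ℂ (eVec R '' Set.Ici 1 ∪ Set.range (dVec R))

theorem exists_of_mem_pastSpan {x : LR R} (hx : x ∈ pastSpan R) :
    ∃ (q : Polynomial ℂ) (g : LTwo), q.coeff 0 = 0 ∧ x = gen R (polyL q, g) := by
  induction hx using Submodule.span_induction with
  | mem x hx =>
    rcases hx with ⟨k, hk, rfl⟩ | ⟨k, rfl⟩
    · simp only [Set.mem_Ici] at hk
      lift k to ℕ using by omega
      refine ⟨Polynomial.X ^ k, 0, ?_, by rw [polyL_X_pow]; rfl⟩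
      rw [Polynomial.coeff_X_pow, if_neg (by omega)]
    · exact ⟨0, fourierLp 2 (-(k + 1)), by simp, by simp [dVec]⟩
  | zero => exact ⟨0, 0, by simp, by rw [map_zero, ← Prod.zero_eq_mk, map_zero]⟩
  | add x y _ _ hx hy =>
    obtain ⟨q, g, h1, rfl⟩ := hx
    obtain ⟨q', g', h2, rfl⟩ := hy
    exact ⟨q + q', g + g', by simp [h1, h2], by rw [← map_add, Prod.mk_add_mk, map_add]⟩
  | smul a x _ hx =>
    obtain ⟨q, g, h1, rfl⟩ := hx
    exact ⟨a • q, a • g, by simp [h1], by rw [← map_smul, Prod.smul_mk, map_smul]⟩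

theorem exp_integral_log_le_norm_sq {p : Polynomial ℂ} (hp : p.coeff 0 = 1) (g : LTwo) :
    Real.exp (∫ t, Real.log (1 - ‖R t‖) ∂leb) ≤ ‖gen R (polyL p, g)‖ ^ 2 := by
  have hle : ∀ᵐ t ∂leb, (1 - ‖R t‖) * ‖p.eval (fourier 1 t)‖ ^ 2 ≤
      quad (R t) ((gen R (polyL p, g)).fn t) := by
    filter_upwards [R.norm_lt_one, coeFn_genFun R (polyL p, g), coeFn_polyL p] with t ht h1 h2
    change _ ≤ quad (R t) (genFun R (polyL p, g) t)
    rw [h1, ← h2]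
    exact le_quad_gram ht _ _
  have hw : ∀ᵐ t ∂leb, 0 < 1 - ‖R t‖ := R.norm_lt_one.mono fun t ht => sub_pos.mpr ht
  have hint : Integrable (fun t => (1 - ‖R t‖) * ‖p.eval (fourier 1 t)‖ ^ 2) leb := by
    refine (gen R (polyL p, g)).fn_mem.quad.mono'
      ((aestronglyMeasurable_const.sub R.aestronglyMeasurable.norm).mul
        ((p.continuous.comp (fourier 1).continuous).norm.pow 2).aestronglyMeasurable) ?_
    filter_upwards [hle, hw] with t h1 h2
    rwa [Real.norm_of_nonneg (by positivity)]
  rw [LR.norm_sq_eq]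
  exact (exp_integral_log_le hw R.integrable_log hp hint).trans
    (integral_mono_ae hint (gen R (polyL p, g)).fn_mem.quad hle)

/-- The difference of `e_0` and an element of `pastSpan R` has a first coordinate (before applying
the matrix) that is a polynomial with constant term `1`. Szegő's bound therefore keeps its distance
from `e_0` away from zero. -/
theorem eVec_zero_notMem_closure : eVec R 0 ∉ (pastSpan R).topologicalClosure := by
  intro hmem
  set c := Real.exp (∫ t, Real.log (1 - ‖R t‖) ∂leb)
  have hc : 0 < c := Real.exp_pos _
  obtain ⟨x, hx, hd⟩ := Metric.mem_closure_iff.mp hmem (√c) (Real.sqrt_pos.mpr hc)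
  obtain ⟨q, g, hq, rfl⟩ := exists_of_mem_pastSpan hx
  have h1 : eVec R 0 - gen R (polyL q, g) = gen R (polyL (1 - q), -g) := by
    have := polyL_X_pow 0
    rw [pow_zero, Nat.cast_zero] at this
    rw [eVec, ← map_sub, map_sub polyL, this, Prod.mk_sub_mk, zero_sub]
  rw [dist_eq_norm, h1] at hd
  have h2 := exp_integral_log_le_norm_sq (R := R) (p := 1 - q) (by simp [hq]) (-g)
  have h3 : ‖gen R (polyL (1 - q), -g)‖ ^ 2 < c := by
    rw [← Real.sq_sqrt hc.le]
    exact pow_lt_pow_left₀ hd (norm_nonneg _) two_ne_zero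
  exact absurd h3 (not_lt.mpr h2)

theorem mulPow_succ (k : ℕ) (f : LR R) :
    mulPow R ((k + 1 : ℕ) : ℤ) f = UR R (mulPow R k f) := by
  refine LR.ext (AEEqFun.ext ?_)
  filter_upwards [coeFn_mulPow R ((k + 1 : ℕ) : ℤ) f, coeFn_mulPow R k f,
    UR_apply R (mulPow R k f)] with t h1 h2 h3
  rw [h1, h3, h2, smul_smul, ← fourier_add, Nat.cast_succ, add_comm]

theorem UR_mem_closure_pastSpan {x : LR R} (hx : x ∈ (pastSpan R).topologicalClosure) :
    UR R x ∈ (pastSpan R).topologicalClosure := by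
  refine map_mem_closure (UR R).continuous hx fun y hy => ?_
  have : pastSpan R ≤ (pastSpan R).comap (UR R).toLinearEquiv.toLinearMap := by
    refine Submodule.span_le.mpr ?_
    rintro _ (⟨k, hk, rfl⟩ | ⟨k, rfl⟩)
    · refine Submodule.subset_span (Or.inl ⟨k + 1, ?_, (UR_eVec k).symm⟩)
      simp only [Set.mem_Ici] at hk ⊢
      omega
    · exact Submodule.subset_span (Or.inr ⟨k - 1, (UR_dVec k).symm⟩)
  exact this hy

/-- The outer vector: its first component is the boundary value of the complex conjugate of an outer
function with squared modulus proportional to `1 - |R|²`, and its second component vanishes. -/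
theorem exists_outer : ∃ F : LR R, (∀ k, 1 ≤ k → inner ℂ (eVec R k) F = 0) ∧
    (∀ k, inner ℂ (dVec R k) F = 0) ∧ inner ℂ (eVec R 0) F ≠ 0 ∧
    ∃ c : ℝ, 0 < c ∧ ∀ᵐ t ∂leb, quad (R t) (F.fn t) = c := by
  set N := (pastSpan R).topologicalClosure with hN
  have : CompleteSpace N := (Submodule.isClosed_topologicalClosure _).completeSpace_coe
  -- `F` is the component of `e_0` orthogonal to `N`.
  obtain ⟨y, hy, F, hF, hyF⟩ := N.exists_add_mem_mem_orthogonal (eVec R 0)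
  have hF0 : F ≠ 0 := by
    rintro rfl
    rw [add_zero] at hyF
    exact eVec_zero_notMem_closure (R := R) (hyF ▸ hy)
  have hmem : ∀ x ∈ eVec R '' Set.Ici 1 ∪ Set.range (dVec R), x ∈ N := fun x hx =>
    Submodule.le_topologicalClosure _ (Submodule.subset_span hx)
  -- Since `t F = e_1 - t y` and `N` is invariant under the shift, all positive translates of `F`
  -- lie in `N`, hence are orthogonal to `F`. These relations are the vanishing Fourier coefficients
  -- of the pointwise weighted norm of `F`; the coefficients of opposite sign follow by conjugation.
  have hshift : ∀ k : ℕ, mulPow R ((k + 1 : ℕ) : ℤ) F ∈ N := by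
    intro k
    induction k with
    | zero =>
      have e : mulPow R ((0 + 1 : ℕ) : ℤ) F = eVec R 1 - UR R y := by
        have h1 : UR R F = eVec R 1 - UR R y := by
          have := UR_eVec (R := R) 0
          rw [hyF, map_add, zero_add] at this
          rw [← this, add_sub_cancel_left]
        exact h1
      rw [e]
      exact Submodule.sub_mem _ (hmem _ (Or.inl ⟨1, by simp, rfl⟩)) (UR_mem_closure_pastSpan hy)
    | succ k ih =>
      rw [mulPow_succ]
      exact UR_mem_closure_pastSpan ih
  have hpos : 0 < ∫ t, quad (R t) (F.fn t) ∂leb := by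
    rw [← LR.norm_sq_eq]
    exact pow_pos (norm_pos_iff.mpr hF0) 2
  have hcoef : ∀ k : ℕ, ∫ t, conj (fourier ((k + 1 : ℕ) : ℤ) t) * (quad (R t) (F.fn t) : ℂ) ∂leb
      = 0 := by
    intro k
    rw [← hF _ (hshift k), inner_mulPow_left]
    refine integral_congr_ae ?_
    filter_upwards [R.norm_lt_one] with t ht
    rw [form_self ht]
  refine ⟨F, fun k hk => hF _ (hmem _ (Or.inl ⟨k, hk, rfl⟩)),
    fun k => hF _ (hmem _ (Or.inr ⟨k, rfl⟩)), ?_, _, hpos,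
    ae_eq_const_of_integral_fourier_eq_zero F.fn_mem.quad (quad_ae_nonneg F) ?_⟩
  · rw [hyF, inner_add_left, hF y hy, zero_add]
    exact inner_self_ne_zero.mpr hF0
  · intro k hk
    rcases lt_or_gt_of_ne hk with h | h
    · obtain ⟨j, rfl⟩ : ∃ j : ℕ, k = -((j + 1 : ℕ) : ℤ) := ⟨(-k - 1).toNat, by omega⟩
      simpa only [fourier_neg] using hcoef j
    · obtain ⟨j, rfl⟩ : ∃ j : ℕ, k = ((j + 1 : ℕ) : ℤ) := ⟨(k - 1).toNat, by omega⟩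
      have := congrArg conj (hcoef j)
      rw [← integral_conj, map_zero] at this
      simpa only [map_mul, Complex.conj_conj, Complex.conj_ofReal] using this

/-! ### The conjugation that exchanges the two components. -/

theorem quad_conj_swap {z : ℂ} (hz : ‖z‖ < 1) (u : Fin 2 → ℂ) :
    quad z ![conj (u 1), conj (u 0)] = quad z u := by
  apply Complex.ofReal_injective
  rw [← form_self hz, ← form_self hz, form_eq hz, form_eq hz]
  have h := one_sub_ne hz
  have h' : (((1 - ‖z‖ ^ 2)⁻¹ : ℝ) : ℂ) = (1 - conj z * z)⁻¹ := by
    rw [Complex.conj_mul']; push_cast; ring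
  rw [h']
  simp only [Matrix.cons_val_zero, Matrix.cons_val_one, Matrix.cons_val_fin_one, map_sub, map_mul,
    Complex.conj_conj]
  have h2 := inv_mul_cancel₀ h
  linear_combination (conj (u 0) * u 0 - conj (u 1) * u 1) * h2

/-- The conjugation `[f₁; f₂] ↦ [f̄₂; f̄₁]` of `L^R`. -/
noncomputable def conjSwapFun (f : LR R) : 𝕋 →ₘ[leb] (Fin 2 → ℂ) :=
  AEEqFun.mk (fun t => ![conj (f.fn t 1), conj (f.fn t 0)]) (by
    refine (aemeasurable_pi_iff.mpr fun i => ?_).aestronglyMeasurable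
    fin_cases i
    · exact (Complex.continuous_conj.comp_aestronglyMeasurable
        (f.aestronglyMeasurable_apply 1)).aemeasurable
    · exact (Complex.continuous_conj.comp_aestronglyMeasurable
        (f.aestronglyMeasurable_apply 0)).aemeasurable)

/-- The conjugation `[f₁; f₂] ↦ [f̄₂; f̄₁]` of `L^R`. -/
noncomputable def conjSwap (f : LR R) : LR R := ⟨conjSwapFun f, by
  refine HasFiniteNorm.of_le f.fn_mem.quad ?_
  filter_upwards [AEEqFun.coeFn_mk (μ := leb) (fun t => ![conj (f.fn t 1), conj (f.fn t 0)]) _]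
    with t ht hR
  rw [conjSwapFun, ht, quad_conj_swap hR]⟩

theorem coeFn_conjSwap (f : LR R) :
    (conjSwap f).fn =ᵐ[leb] fun t => ![conj (f.fn t 1), conj (f.fn t 0)] :=
  AEEqFun.coeFn_mk _ _

/-- The conjugation exchanges `e_{k+1}` and `d_k`, so facts about one family of generators transfer
to the other. -/
theorem inner_dVec_conjSwap (k : ℤ) (f : LR R) :
    inner ℂ (dVec R k) (conjSwap f) = conj (inner ℂ (eVec R (k + 1)) f) := by
  rw [inner_dVec, inner_eVec, ← integral_conj]
  refine integral_congr_ae ?_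
  filter_upwards [coeFn_conjSwap f] with t h
  rw [h, fourier_neg]
  simp only [Matrix.cons_val_one, Matrix.cons_val_fin_one, map_mul]

theorem inner_eVec_conjSwap (k : ℤ) (f : LR R) :
    inner ℂ (eVec R k) (conjSwap f) = conj (inner ℂ (dVec R (k - 1)) f) := by
  rw [inner_dVec, inner_eVec, ← integral_conj]
  refine integral_congr_ae ?_
  filter_upwards [coeFn_conjSwap f] with t h
  rw [h, sub_add_cancel, fourier_neg]
  simp only [Matrix.cons_val_zero, map_mul, Complex.conj_conj]

/-! ### Strictness of the steps, trivial intersection and dense union. -/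

theorem eVec_notMem_H (n m : ℤ) : eVec R n ∉ H R (n + 1) m := by
  obtain ⟨F, h1, h2, h3, -⟩ := exists_outer (R := R)
  have : mulPow R n F ∈ (H R (n + 1) m)ᗮ := by
    refine mem_orthogonal_H (fun k hk => ?_) fun k _ => ?_
    · rw [inner_eVec_mulPow, h1 _ (by omega)]
    · rw [inner_dVec_mulPow, h2]
  intro hmem
  have h4 := this _ hmem
  rw [inner_eVec_mulPow, sub_self] at h4
  exact h3 h4

theorem dVec_notMem_H (n m : ℤ) : dVec R m ∉ H R n (m + 1) := by
  obtain ⟨F, h1, h2, h3, -⟩ := exists_outer (R := R)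
  have : mulPow R (-m - 1) (conjSwap F) ∈ (H R n (m + 1))ᗮ := by
    refine mem_orthogonal_H (fun k _ => ?_) fun k hk => ?_
    · rw [inner_eVec_mulPow, inner_eVec_conjSwap, h2, map_zero]
    · rw [inner_dVec_mulPow, inner_dVec_conjSwap, h1 _ (by omega), map_zero]
  intro hmem
  have h4 := this _ hmem
  rw [inner_dVec_mulPow, inner_dVec_conjSwap, show m + (-m - 1) + 1 = 0 by ring] at h4
  exact h3 ((map_eq_zero _).mp h4)

/-- Orthogonality to all translates of `G` kills every Fourier coefficient of the pointwise product.
Cauchy-Schwarz and the constancy of the pointwise norm of `G` put that product in `L²`, where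
uniqueness applies. -/
theorem form_ae_eq_zero {G f : LR R} {c : ℝ} (hG : ∀ᵐ t ∂leb, quad (R t) (G.fn t) = c)
    (h : ∀ k, inner ℂ (mulPow R k G) f = 0) : ∀ᵐ t ∂leb, form (R t) (G.fn t) (f.fn t) = 0 := by
  refine ae_eq_zero_of_integral_fourier_eq_zero ?_ fun k => by rw [← inner_mulPow_left, h]
  have hm := aestronglyMeasurable_form R G.fn f.fn
  rw [memLp_two_iff_integrable_sq_norm hm]
  refine (f.fn_mem.quad.const_mul c).mono' (hm.norm.pow 2) ?_
  filter_upwards [R.norm_lt_one, hG] with t ht h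
  rw [Real.norm_of_nonneg (sq_nonneg _), ← h]
  exact norm_form_sq_le ht _ _

theorem eq_zero_of_form_eq_zero {z a : ℂ} (hz : ‖z‖ < 1) (ha : a ≠ 0) {v : Fin 2 → ℂ}
    (h1 : form z ![a, 0] v = 0) (h2 : form z ![0, conj a] v = 0) : v 0 = 0 ∧ v 1 = 0 := by
  have hd : (((1 - ‖z‖ ^ 2)⁻¹ : ℝ) : ℂ) ≠ 0 := Complex.ofReal_ne_zero.mpr (inv_nonneg_of_lt hz).ne'
  rw [form_eq hz] at h1 h2
  have h3 : v 1 - z * v 0 = 0 := by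
    simp only [Matrix.cons_val_zero, Matrix.cons_val_one, Matrix.cons_val_fin_one, map_zero,
      zero_mul, zero_add, mul_zero, sub_zero, Complex.conj_conj] at h2
    exact (mul_eq_zero.mp ((mul_eq_zero.mp h2).resolve_right hd)).resolve_left ha
  have h4 : v 0 = 0 := by simpa [ha, h3] using h1
  exact ⟨h4, by simpa [h4] using h3⟩

/-- Every translate of `F` and of its conjugate is orthogonal to some `H R n n`, hence to `f`. At
almost every point `F = [a; 0]` and its conjugate is `[0; ā]`, with `a ≠ 0` because the weighted
norm is a positive constant. These two vectors span `ℂ²`. -/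
theorem eq_zero_of_forall_mem_H {f : LR R} (hf : ∀ n, f ∈ H R n n) : f = 0 := by
  obtain ⟨F, h1, h2, -, c, hc, hq⟩ := exists_outer (R := R)
  have hq' : ∀ᵐ t ∂leb, quad (R t) ((conjSwap F).fn t) = c := by
    filter_upwards [R.norm_lt_one, hq, coeFn_conjSwap F] with t ht h3 h4
    rw [h4, quad_conj_swap ht, h3]
  have k1 := form_ae_eq_zero (f := f) hq fun k => by
    refine inner_eq_zero_symm.mp (Submodule.mem_orthogonal _ _ |>.mp ?_ _ (hf (k + 1)))
    refine mem_orthogonal_H (fun j hj => ?_) fun j _ => ?_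
    · rw [inner_eVec_mulPow, h1 _ (by omega)]
    · rw [inner_dVec_mulPow, h2]
  have k2 := form_ae_eq_zero (f := f) hq' fun k => by
    refine inner_eq_zero_symm.mp (Submodule.mem_orthogonal _ _ |>.mp ?_ _ (hf (-k)))
    refine mem_orthogonal_H (fun j _ => ?_) fun j hj => ?_
    · rw [inner_eVec_mulPow, inner_eVec_conjSwap, h2, map_zero]
    · rw [inner_dVec_mulPow, inner_dVec_conjSwap, h1 _ (by omega), map_zero]
  have key : ∀ᵐ t ∂leb, f.fn t 0 = 0 ∧ f.fn t 1 = 0 := by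
    filter_upwards [R.norm_lt_one, k1, k2, hq, coeFn_conjSwap F, fn_one_eq_zero h2]
      with t ht e1 e2 e3 e4 e5
    have hF : F.fn t = ![F.fn t 0, 0] := by
      funext i
      fin_cases i
      · rfl
      · exact e5
    rw [e4, e5, map_zero] at e2
    rw [hF] at e1
    refine eq_zero_of_form_eq_zero ht (fun h0 => ?_) e1 e2
    rw [hF, h0] at e3
    simp [quad] at e3
    exact hc.ne e3
  exact LR.eq_zero_of_ae (key.mono fun t h => h.1) (key.mono fun t h => h.2)

/-- Such an `f` is orthogonal to all `e_k` and `d_k`, so all Fourier coefficients of both components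
vanish. -/
theorem eq_zero_of_forall_mem_orthogonal_H {f : LR R} (hf : ∀ n, f ∈ (H R n n)ᗮ) : f = 0 :=
  LR.eq_zero_of_ae (fn_zero_eq_zero fun k => hf k _ (eVec_mem_H le_rfl))
    (fn_one_eq_zero fun k => hf k _ (dVec_mem_H le_rfl))

/-! ### One-dimensional steps between subspaces of an inner product space. -/

section Abstract

variable {E : Type*} [NormedAddCommGroup E] [InnerProductSpace ℂ E]

theorem exists_ofReal_of_pos {z : ℂ} (hz : 0 < z) : ∃ r : ℝ, 0 < r ∧ z = r := by
  rw [Complex.pos_iff] at hz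
  exact ⟨z.re, hz.1, Complex.ext rfl hz.2.symm⟩

/-- `A` is a subspace of `B` of codimension one and `e` spans `B` modulo `A`. -/
structure IsStep (A B : Submodule ℂ E) (e : E) : Prop where
  le : A ≤ B
  mem : e ∈ B
  notMem : e ∉ A
  exists_sub_mem : ∀ x ∈ B, ∃ a : ℂ, x - a • e ∈ A

/-- `v` is the unit vector of `B ⊖ A` normalized by `⟨v, e⟩ > 0`. -/
structure IsNormalVec (A B : Submodule ℂ E) (e v : E) : Prop where
  mem : v ∈ B
  mem_orthogonal : v ∈ Aᗮ
  norm_eq : ‖v‖ = 1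
  pos : 0 < inner ℂ e v

variable {A B D A₁ A₂ : Submodule ℂ E} {e d v w : E}

theorem IsStep.isCodimOne (h : IsStep A B e) : IsCodimOne A B := by
  refine ⟨h.le, finrank_eq_one (Submodule.Quotient.mk ⟨e, h.mem⟩) ?_ ?_⟩
  · rw [Ne, Submodule.Quotient.mk_eq_zero]
    exact h.notMem
  · intro q
    induction q using Submodule.Quotient.induction_on with
    | H x =>
      obtain ⟨a, ha⟩ := h.exists_sub_mem x x.2
      refine ⟨a, ?_⟩
      rw [← Submodule.Quotient.mk_smul, eq_comm, Submodule.Quotient.eq]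
      exact ha

theorem inner_self_eq_one (hv : ‖v‖ = 1) : inner ℂ v v = 1 := by
  rw [inner_self_eq_norm_sq_to_K, hv]; simp

theorem IsStep.mem_of_inner_eq_zero (h : IsStep A B e) (hv : IsNormalVec A B e v) {x : E}
    (hx : x ∈ B) (h0 : inner ℂ v x = 0) : x ∈ A := by
  obtain ⟨a, ha⟩ := h.exists_sub_mem x hx
  have h1 := inner_eq_zero_symm.mp (hv.mem_orthogonal _ ha)
  rw [inner_sub_right, h0, inner_smul_right, zero_sub, neg_eq_zero] at h1
  rcases mul_eq_zero.mp h1 with h2 | h2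
  · simpa [h2] using ha
  · exact absurd (inner_eq_zero_symm.mp h2) hv.pos.ne'

/-- Modulo `A`, `v` is a positive multiple of `e`, and `w` does not see `A`. As `w` need not lie in
`B`, this compares normalizations across different steps with the same `e`. -/
theorem IsNormalVec.inner_pos (h : IsStep A B e) (hv : IsNormalVec A B e v) (hw : w ∈ Aᗮ)
    (hp : 0 < inner ℂ e w) : 0 < inner ℂ v w := by
  obtain ⟨a, ha⟩ := h.exists_sub_mem v hv.mem
  have h1 := hw _ ha
  have h2 := hv.mem_orthogonal _ ha
  rw [inner_sub_left, inner_smul_left, sub_eq_zero] at h1 h2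
  rw [inner_self_eq_one hv.norm_eq] at h2
  obtain ⟨r, hr, hr'⟩ := exists_ofReal_of_pos hv.pos
  obtain ⟨s, hs, hs'⟩ := exists_ofReal_of_pos hp
  rw [hr'] at h2
  rw [hs'] at h1
  have hr0 : (r : ℂ) ≠ 0 := Complex.ofReal_ne_zero.mpr hr.ne'
  have : inner ℂ v w = ((s / r : ℝ) : ℂ) := by
    rw [h1, Complex.ofReal_div, eq_div_iff hr0]
    linear_combination (-(s : ℂ)) * h2
  rw [this]
  exact_mod_cast div_pos hs hr

theorem IsStep.eq_of_isNormalVec (h : IsStep A B e) (hv : IsNormalVec A B e v)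
    (hw : IsNormalVec A B e w) : v = w := by
  have h1 : v - inner ℂ w v • w ∈ A := by
    refine h.mem_of_inner_eq_zero hw (Submodule.sub_mem _ hv.mem (Submodule.smul_mem _ _ hw.mem)) ?_
    rw [inner_sub_right, inner_smul_right, inner_self_eq_one hw.norm_eq, mul_one, sub_self]
  have h2 : v - inner ℂ w v • w ∈ Aᗮ :=
    Submodule.sub_mem _ hv.mem_orthogonal (Submodule.smul_mem _ _ hw.mem_orthogonal)
  have h3 : v = inner ℂ w v • w := sub_eq_zero.mp (inner_self_eq_zero.mp (h2 _ h1))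
  obtain ⟨r, hr, hr'⟩ := exists_ofReal_of_pos (hw.inner_pos h hv.mem_orthogonal hv.pos)
  rw [hr'] at h3
  have h4 := congrArg norm h3
  rw [norm_smul, hv.norm_eq, hw.norm_eq, mul_one, Complex.norm_real, Real.norm_of_nonneg hr.le] at h4
  rw [h3, ← h4, Complex.ofReal_one, one_smul]

theorem IsStep.exists_isNormalVec [CompleteSpace A] (h : IsStep A B e) :
    ∃ v, IsNormalVec A B e v := by
  obtain ⟨y, hy, z, hz, hyz⟩ := A.exists_add_mem_mem_orthogonal e
  have hz0 : z ≠ 0 := by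
    rintro rfl
    rw [add_zero] at hyz
    exact h.notMem (hyz ▸ hy)
  have hzn : (‖z‖ : ℂ) ≠ 0 := Complex.ofReal_ne_zero.mpr (norm_ne_zero_iff.mpr hz0)
  have hzB : z ∈ B := by
    rw [← add_sub_cancel_left y z, ← hyz]
    exact Submodule.sub_mem _ h.mem (h.le hy)
  refine ⟨((‖z‖ : ℂ)⁻¹) • z, Submodule.smul_mem _ _ hzB, Submodule.smul_mem _ _ hz, ?_, ?_⟩
  · rw [norm_smul, norm_inv, Complex.norm_real, norm_norm,
      inv_mul_cancel₀ (norm_ne_zero_iff.mpr hz0)]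
  · have : inner ℂ e ((‖z‖ : ℂ)⁻¹ • z) = ((‖z‖ : ℝ) : ℂ) := by
      rw [hyz, inner_smul_right, inner_add_left, hz y hy, zero_add, inner_self_eq_norm_sq_to_K]
      rw [inv_mul_eq_iff_eq_mul₀ hzn, sq]
      rfl
    rw [this]
    exact_mod_cast norm_pos_iff.mpr hz0

/-- The relations between the normal vectors of a square of subspaces `D ≤ A₁, A₂ ≤ B` all of whose
sides are steps. -/
theorem szego_recursion {k kt k' kt' : E} (hBe : IsStep A₁ B e) (hBd : IsStep A₂ B d)
    (hDe : IsStep D A₂ e) (hDd : IsStep D A₁ d) (hk : IsNormalVec A₁ B e k)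
    (hkt : IsNormalVec A₂ B d kt) (hk' : IsNormalVec D A₂ e k') (hkt' : IsNormalVec D A₁ d kt') :
    ‖(inner ℂ kt k : ℂ)‖ < 1 ∧
    k = (inner ℂ kt k : ℂ) • kt + (rho (inner ℂ kt k) : ℂ) • k' ∧
    kt' = (rho (inner ℂ kt k) : ℂ) • kt - conj (inner ℂ kt k) • k' := by
  have hktk' : inner ℂ kt k' = 0 := inner_eq_zero_symm.mp (hkt.mem_orthogonal _ hk'.mem)
  -- The path from `B` through `A₂` to `D` makes `kt, k'` an orthonormal basis of the plane `B ⊖ D`;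
  -- the path through `A₁` provides the other basis `k, kt'`.
  have hexp : ∀ x ∈ B, x ∈ Dᗮ → x = (inner ℂ kt x : ℂ) • kt + (inner ℂ k' x : ℂ) • k' := by
    intro x hx hxD
    set a : ℂ := inner ℂ kt x with ha
    set b : ℂ := inner ℂ k' x with hb
    have hyB : x - a • kt - b • k' ∈ B := Submodule.sub_mem _ (Submodule.sub_mem _ hx
      (Submodule.smul_mem _ _ hkt.mem)) (Submodule.smul_mem _ _ (hBd.le hk'.mem))
    have hyA : x - a • kt - b • k' ∈ A₂ := by
      refine hBd.mem_of_inner_eq_zero hkt hyB ?_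
      rw [inner_sub_right, inner_sub_right, inner_smul_right, inner_smul_right,
        inner_self_eq_one hkt.norm_eq, hktk']
      simp [ha]
    have hyD : x - a • kt - b • k' ∈ D := by
      refine hDe.mem_of_inner_eq_zero hk' hyA ?_
      rw [inner_sub_right, inner_sub_right, inner_smul_right, inner_smul_right,
        inner_self_eq_one hk'.norm_eq, inner_eq_zero_symm.mp hktk']
      simp [hb]
    have hyD' : x - a • kt - b • k' ∈ Dᗮ := Submodule.sub_mem _ (Submodule.sub_mem _ hxD
      (Submodule.smul_mem _ _ (Submodule.orthogonal_le hDe.le hkt.mem_orthogonal)))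
      (Submodule.smul_mem _ _ hk'.mem_orthogonal)
    have h0 : x - a • kt - b • k' = 0 := inner_self_eq_zero.mp (hyD' _ hyD)
    rw [sub_sub] at h0
    exact sub_eq_zero.mp h0
  have hkD : k ∈ Dᗮ := Submodule.orthogonal_le hDd.le hk.mem_orthogonal
  have hktD : kt ∈ Dᗮ := Submodule.orthogonal_le hDe.le hkt.mem_orthogonal
  have e1 := hexp k hk.mem hkD
  have e2 := hexp kt' (hBe.le hkt'.mem) hkt'.mem_orthogonal
  -- Opposite sides of the square share the normalizing vector, `e` or `d`, so both off-diagonal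
  -- coefficients are positive.
  obtain ⟨s, hs, hs'⟩ := exists_ofReal_of_pos (hk'.inner_pos hDe hkD hk.pos)
  obtain ⟨b, hb, hb'⟩ := exists_ofReal_of_pos (hkt'.inner_pos hDd hktD hkt.pos)
  have hb'' : inner ℂ kt kt' = (b : ℂ) := by
    rw [← inner_conj_symm, hb', Complex.conj_ofReal]
  set α : ℂ := inner ℂ kt k
  set γ : ℂ := inner ℂ k' kt'
  rw [hs'] at e1
  rw [hb''] at e2
  have hcomb : ∀ p q p' q' : ℂ, inner ℂ (p • kt + q • k') (p' • kt + q' • k') =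
      conj p * p' + conj q * q' := by
    intro p q p' q'
    simp only [inner_add_left, inner_add_right, inner_smul_left, inner_smul_right,
      inner_self_eq_one hkt.norm_eq, inner_self_eq_one hk'.norm_eq, hktk',
      inner_eq_zero_symm.mp hktk']
    ring
  have n1 : ‖α‖ ^ 2 + s ^ 2 = 1 := by
    have h := inner_self_eq_one hk.norm_eq
    rw [e1, hcomb, Complex.conj_mul', Complex.conj_ofReal] at h
    apply Complex.ofReal_injective
    push_cast
    linear_combination h
  have n2 : b ^ 2 + ‖γ‖ ^ 2 = 1 := by
    have h := inner_self_eq_one hkt'.norm_eq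
    rw [e2, hcomb, Complex.conj_ofReal, Complex.conj_mul'] at h
    apply Complex.ofReal_injective
    push_cast
    linear_combination h
  have n3 : conj α * b + s * γ = 0 := by
    have h := inner_eq_zero_symm.mp (hk.mem_orthogonal _ hkt'.mem)
    rwa [e1, e2, hcomb, Complex.conj_ofReal] at h
  have n4 : s * ‖γ‖ = b * ‖α‖ := by
    have h := congrArg norm (eq_neg_of_add_eq_zero_right n3)
    rwa [norm_neg, norm_mul, norm_mul, RCLike.norm_conj, Complex.norm_real, Complex.norm_real,
      Real.norm_of_nonneg hs.le, Real.norm_of_nonneg hb.le, mul_comm ‖α‖] at h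
  have n5 : b = s := by
    refine (sq_eq_sq₀ hb.le hs.le).mp ?_
    have h : (s * ‖γ‖) ^ 2 = (b * ‖α‖) ^ 2 := by rw [n4]
    -- Eliminating `|α|` and `|γ|` from the two unit norms and the orthogonality relation leaves `b²
    -- = s²`.
    linear_combination (b ^ 2) * (-n1) + (s ^ 2) * n2 - h
  have hρ : rho α = s := by
    rw [rho, show 1 - ‖α‖ ^ 2 = s ^ 2 by linarith, Real.sqrt_sq hs.le]
  have hγ : γ = -conj α := by
    have hs0 : (s : ℂ) ≠ 0 := Complex.ofReal_ne_zero.mpr hs.ne'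
    rw [n5] at n3
    refine mul_left_cancel₀ hs0 ?_
    linear_combination n3
  refine ⟨?_, ?_, ?_⟩
  · nlinarith [norm_nonneg α, pow_pos hs 2]
  · rw [hρ]; exact e1
  · rw [hρ, ← n5, sub_eq_add_neg, ← neg_smul, ← hγ]; exact e2

/-- The unit normal vectors of a decreasing two-sided chain of subspaces are orthonormal. -/
theorem orthonormal_of_chain {G : ℤ → Submodule ℂ E} {v : ℤ → E} (hG : Antitone G)
    (hv : ∀ k, v k ∈ G k) (hv' : ∀ k, v k ∈ (G (k + 1))ᗮ) (hn : ∀ k, ‖v k‖ = 1) :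
    Orthonormal ℂ v := by
  refine ⟨hn, fun i j hij => ?_⟩
  rcases lt_or_gt_of_ne hij with h | h
  · exact inner_eq_zero_symm.mp (hv' i _ (hG (by omega) (hv j)))
  · exact hv' j _ (hG (by omega) (hv i))

/-- The unit normal vectors of a decreasing two-sided chain of subspaces with trivial intersection
and dense union span a dense subspace. -/
theorem span_orthogonal_eq_bot_of_chain {G : ℤ → Submodule ℂ E} {v : ℤ → E}
    [CompleteSpace (G 0)] (hG : Antitone G) (hv' : ∀ k, v k ∈ (G (k + 1))ᗮ)
    (hv : ∀ k, v k ∈ G k) (hn : ∀ k, ‖v k‖ = 1)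
    (hstep : ∀ k, ∀ x ∈ G k, inner ℂ (v k) x = 0 → x ∈ G (k + 1))
    (hinf : ∀ x, (∀ k, x ∈ G k) → x = 0) (hsup : ∀ x, (∀ k, x ∈ (G k)ᗮ) → x = 0) :
    (Submodule.span ℂ (Set.range v))ᗮ = ⊥ := by
  rw [Submodule.eq_bot_iff]
  intro f hf
  have hf0 : ∀ k, inner ℂ (v k) f = 0 := fun k => hf _ (Submodule.subset_span ⟨k, rfl⟩)
  obtain ⟨y, hy, z, hz, rfl⟩ := (G 0).exists_add_mem_mem_orthogonal f
  -- Splitting `f` along `G 0` suffices: orthogonality to the `v k` pushes `y` down the chain and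
  -- keeps `z` orthogonal as the chain grows upwards. Thus `y` lies in the intersection and `z` is
  -- orthogonal to the union.
  have key : ∀ k, y ∈ G k ∧ z ∈ (G k)ᗮ := by
    intro k
    induction k using Int.induction_on with
    | zero => exact ⟨hy, hz⟩
    | succ i ih =>
      refine ⟨hstep _ _ ih.1 ?_, Submodule.orthogonal_le (hG (by omega)) ih.2⟩
      have := hf0 i
      rwa [inner_add_right, ih.2 _ (hv i), add_zero] at this
    | pred i ih =>
      have hle : G (-(i : ℤ)) ≤ G (-(i : ℤ) - 1) := hG (by omega)
      have horth := hv' (-(i : ℤ) - 1)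
      rw [sub_add_cancel] at horth
      refine ⟨hle ih.1, fun x hx => ?_⟩
      set u := v (-(i : ℤ) - 1) with hu
      have h1 : x - inner ℂ u x • u ∈ G (-(i : ℤ)) := by
        have := hstep (-(i : ℤ) - 1) (x - inner ℂ u x • u)
          (Submodule.sub_mem _ hx (Submodule.smul_mem _ _ (hv _))) (by
            rw [← hu, inner_sub_right, inner_smul_right, inner_self_eq_one (hn _), mul_one,
              sub_self])
        rwa [sub_add_cancel] at this
      have h2 : inner ℂ u z = 0 := by
        have := hf0 (-(i : ℤ) - 1)
        rwa [inner_add_right, ← hu, inner_eq_zero_symm.mp (horth _ ih.1), zero_add] at this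
      have h3 := ih.2 _ h1
      rwa [inner_sub_left, inner_smul_left, h2, mul_zero, sub_zero] at h3
  rw [hinf y fun k => (key k).1, hsup z fun k => (key k).2, add_zero]

end Abstract

/-! ### The subspaces `H R n m` form a lattice of one-dimensional steps. -/

/-- A closed subspace plus a line is closed, so one extra generator enlarges the closed span by at
most one dimension. -/
theorem mem_closure_span_insert {E : Type*} [NormedAddCommGroup E] [InnerProductSpace ℂ E]
    {s : Set E} {e x : E} (hx : x ∈ (Submodule.span ℂ (insert e s)).topologicalClosure) :
    ∃ a : ℂ, x - a • e ∈ (Submodule.span ℂ s).topologicalClosure := by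
  have hle : (Submodule.span ℂ (insert e s)).topologicalClosure ≤
      (Submodule.span ℂ s).topologicalClosure ⊔ Submodule.span ℂ {e} := by
    refine Submodule.topologicalClosure_minimal _ ?_
      (Submodule.isClosed_sup_finiteDimensional _ _ (Submodule.isClosed_topologicalClosure _))
    rw [Submodule.span_insert, sup_comm]
    exact sup_le_sup_right (Submodule.le_topologicalClosure _) _
  obtain ⟨y, hy, z, hz, rfl⟩ := Submodule.mem_sup.mp (hle hx)
  obtain ⟨a, rfl⟩ := Submodule.mem_span_singleton.mp hz
  exact ⟨a, by rwa [add_sub_cancel_right]⟩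

theorem H_anti {n n' m m' : ℤ} (hn : n ≤ n') (hm : m ≤ m') : H R n' m' ≤ H R n m := by
  rw [H_eq, H_eq]
  exact Submodule.topologicalClosure_mono (Submodule.span_mono (Set.union_subset_union
    (Set.image_mono (Set.Ici_subset_Ici.mpr hn)) (Set.image_mono (Set.Ici_subset_Ici.mpr hm))))

theorem Ici_eq_insert (n : ℤ) : Set.Ici n = insert n (Set.Ici (n + 1)) := by
  ext k
  simp only [Set.mem_Ici, Set.mem_insert_iff]
  omega

theorem isStep_eVec (n m : ℤ) : IsStep (H R (n + 1) m) (H R n m) (eVec R n) where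
  le := H_anti (by omega) le_rfl
  mem := eVec_mem_H le_rfl
  notMem := eVec_notMem_H n m
  exists_sub_mem x hx := by
    rw [H_eq, genSet, Ici_eq_insert, Set.image_insert_eq, Set.insert_union] at hx
    rw [H_eq]
    exact mem_closure_span_insert hx

theorem isStep_dVec (n m : ℤ) : IsStep (H R n (m + 1)) (H R n m) (dVec R m) where
  le := H_anti le_rfl (by omega)
  mem := dVec_mem_H le_rfl
  notMem := dVec_notMem_H n m
  exists_sub_mem x hx := by
    rw [H_eq, genSet, Ici_eq_insert m, Set.image_insert_eq, Set.union_insert] at hx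
    rw [H_eq]
    exact mem_closure_span_insert hx

theorem isK_iff {n m : ℤ} {x : LR R} :
    IsK R n m x ↔ IsNormalVec (H R (n + 1) m) (H R n m) (eVec R n) x :=
  ⟨fun h => ⟨h.1.1, h.1.2, h.2.1, h.2.2⟩, fun h => ⟨⟨h.1, h.2⟩, h.3, h.4⟩⟩

theorem isKTilde_iff {n m : ℤ} {x : LR R} :
    IsKTilde R n m x ↔ IsNormalVec (H R n (m + 1)) (H R n m) (dVec R m) x :=
  ⟨fun h => ⟨h.1.1, h.1.2, h.2.1, h.2.2⟩, fun h => ⟨⟨h.1, h.2⟩, h.3, h.4⟩⟩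

/-! ### Action of `U_R` on the subspaces and on their normal vectors. -/

theorem map_mem_H (T : LR R →L[ℂ] LR R) {n m n' m' : ℤ}
    (he : ∀ k, n ≤ k → T (eVec R k) ∈ H R n' m') (hd : ∀ k, m ≤ k → T (dVec R k) ∈ H R n' m')
    {x : LR R} (hx : x ∈ H R n m) : T x ∈ H R n' m' := by
  have : H R n m ≤ (H R n' m').comap T.toLinearMap := by
    rw [H_eq n m]
    refine Submodule.topologicalClosure_minimal _ (Submodule.span_le.mpr ?_)
      ((Submodule.isClosed_topologicalClosure _).preimage T.continuous)
    rintro _ (⟨k, hk, rfl⟩ | ⟨k, hk, rfl⟩)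
    · exact he k hk
    · exact hd k hk
  exact this hx

theorem UR_mem_H {n m : ℤ} {x : LR R} (hx : x ∈ H R n m) : UR R x ∈ H R (n + 1) (m - 1) := by
  refine map_mem_H (UR R).toContinuousLinearEquiv.toContinuousLinearMap (fun k hk => ?_)
    (fun k hk => ?_) hx
  · exact (UR_eVec (R := R) k).symm ▸ eVec_mem_H (by omega)
  · exact (UR_dVec (R := R) k).symm ▸ dVec_mem_H (by omega)

theorem UR_symm_mem_H {n m : ℤ} {x : LR R} (hx : x ∈ H R n m) :
    (UR R).symm x ∈ H R (n - 1) (m + 1) := by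
  have h1 : ∀ k, (UR R).symm (eVec R k) = eVec R (k - 1) := fun k => by
    rw [LinearIsometryEquiv.symm_apply_eq, UR_eVec, sub_add_cancel]
  have h2 : ∀ k, (UR R).symm (dVec R k) = dVec R (k + 1) := fun k => by
    rw [LinearIsometryEquiv.symm_apply_eq, UR_dVec, add_sub_cancel_right]
  refine map_mem_H (UR R).symm.toContinuousLinearEquiv.toContinuousLinearMap (fun k hk => ?_)
    (fun k hk => ?_) hx
  · exact (h1 k).symm ▸ eVec_mem_H (by omega)
  · exact (h2 k).symm ▸ dVec_mem_H (by omega)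

theorem UR_mem_orthogonal_H {n m : ℤ} {x : LR R} (hx : x ∈ (H R n m)ᗮ) :
    UR R x ∈ (H R (n + 1) (m - 1))ᗮ := by
  intro y hy
  have h := UR_symm_mem_H hy
  rw [add_sub_cancel_right, sub_add_cancel] at h
  rw [← (UR R).apply_symm_apply y, LinearIsometryEquiv.inner_map_map]
  exact hx _ h

theorem IsK.UR {n m : ℤ} {x : LR R} (hx : IsK R n m x) : IsK R (n + 1) (m - 1) (UR R x) := by
  refine ⟨⟨UR_mem_H hx.1.1, UR_mem_orthogonal_H hx.1.2⟩, ?_, ?_⟩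
  · rw [LinearIsometryEquiv.norm_map, hx.2.1]
  · rw [← UR_eVec, LinearIsometryEquiv.inner_map_map]
    exact hx.2.2

theorem IsKTilde.UR {n m : ℤ} {x : LR R} (hx : IsKTilde R n m x) :
    IsKTilde R (n + 1) (m - 1) (UR R x) := by
  refine ⟨⟨UR_mem_H hx.1.1, ?_⟩, ?_, ?_⟩
  · have := UR_mem_orthogonal_H hx.1.2
    rwa [show m + 1 - 1 = m - 1 + 1 by ring] at this
  · rw [LinearIsometryEquiv.norm_map, hx.2.1]
  · rw [← UR_dVec, LinearIsometryEquiv.inner_map_map]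
    exact hx.2.2

/-! ### Columns of the block diagonal matrices and of the CMV matrix. -/

theorem blockDiag_left_column (α : ℤ → ℂ) {p k : ℤ} (hk : 2 ∣ k - p) (i : ℤ) : blockDiag α p i k =
    if i = k then α k else if i = k + 1 then (rho (α k) : ℂ) else 0 := by
  unfold blockDiag
  split_ifs <;> first | omega | (subst_vars; simp [block])

theorem blockDiag_right_column (α : ℤ → ℂ) {p k : ℤ} (hk : 2 ∣ k - p) (i : ℤ) :
    blockDiag α p i (k + 1) =
      if i = k then (rho (α k) : ℂ) else if i = k + 1 then -conj (α k) else 0 := by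
  unfold blockDiag
  split_ifs <;> first | omega | (subst_vars; simp [block])

/-- Columns `2 * n` and `2 * n + 1` of the even factor live in one block, so only these two indices
contribute to the product. -/
theorem cmvMatrix_apply (α : ℤ → ℂ) (n i j : ℤ) (hj : j = 2 * n ∨ j = 2 * n + 1) :
    cmvMatrix α i j = blockDiag α 1 i (2 * n) * blockDiag α 0 (2 * n) j +
      blockDiag α 1 i (2 * n + 1) * blockDiag α 0 (2 * n + 1) j := by
  unfold cmvMatrix
  rw [finsum_eq_sum_of_support_subset (s := {2 * n, 2 * n + 1}), Finset.sum_pair (by omega)]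
  intro l hl
  simp only [Finset.coe_insert, Finset.coe_singleton, Set.mem_insert_iff, Set.mem_singleton_iff]
  by_contra hne
  rw [not_or] at hne
  refine hl ?_
  have hd : (2 : ℤ) ∣ 2 * n - 0 := ⟨n, by ring⟩
  rcases hj with rfl | rfl
  · simp only [blockDiag_left_column α hd, if_neg hne.1, if_neg hne.2, mul_zero]
  · simp only [blockDiag_right_column α hd, if_neg hne.1, if_neg hne.2, mul_zero]

theorem eq_of_shift_invariant {X : Type*} {g : ℤ → ℤ → X}
    (h : ∀ n m, g n m = g (n + 1) (m - 1)) (n m : ℤ) : g n m = g (n + m) 0 := by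
  induction m using Int.induction_on generalizing n with
  | zero => rw [add_zero]
  | succ i ih =>
    rw [h, add_sub_cancel_right, ih]
    congr 1
    ring
  | pred i ih =>
    have := h (n - 1) (-(i : ℤ))
    rw [sub_add_cancel] at this
    rw [← this, ih]
    congr 1
    ring

/-! ### The staircase chain and its orthonormal basis. -/

/-- The vectors `K n n` and `Kt (n + 1) n` in a single sequence. -/
def interlace {X : Type*} (K Kt : ℤ → ℤ → X) (k : ℤ) : X :=
  if 2 ∣ k then K (k / 2) (k / 2) else Kt (k / 2 + 1) (k / 2)

theorem interlace_even {X : Type*} (K Kt : ℤ → ℤ → X) (n : ℤ) :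
    interlace K Kt (2 * n) = K n n := by
  rw [interlace, if_pos ⟨n, rfl⟩, show 2 * n / 2 = n by omega]

theorem interlace_odd {X : Type*} (K Kt : ℤ → ℤ → X) (n : ℤ) :
    interlace K Kt (2 * n + 1) = Kt (n + 1) n := by
  rw [interlace, if_neg (by omega), show (2 * n + 1) / 2 = n by omega]

variable (R) in
/-- The chain `… ⊇ H n n ⊇ H (n + 1) n ⊇ H (n + 1) (n + 1) ⊇ …`. -/
noncomputable def chain (k : ℤ) : Submodule ℂ (LR R) := H R ((k + 1) / 2) (k / 2)

theorem chain_even (n : ℤ) : chain R (2 * n) = H R n n := by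
  rw [chain, show 2 * n / 2 = n by omega, show (2 * n + 1) / 2 = n by omega]

theorem chain_odd (n : ℤ) : chain R (2 * n + 1) = H R (n + 1) n := by
  rw [chain, show (2 * n + 1) / 2 = n by omega, show (2 * n + 1 + 1) / 2 = n + 1 by omega]

theorem chain_antitone : Antitone (chain R) := fun _ _ h => H_anti (by omega) (by omega)

instance (k : ℤ) : CompleteSpace (chain R k) := inferInstanceAs (CompleteSpace (H R _ _))

theorem exists_step_chain {K Kt : ℤ → ℤ → LR R} (hK : ∀ n m, IsK R n m (K n m))
    (hKt : ∀ n m, IsKTilde R n m (Kt n m)) (k : ℤ) :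
    ∃ e, IsStep (chain R (k + 1)) (chain R k) e ∧
      IsNormalVec (chain R (k + 1)) (chain R k) e (interlace K Kt k) := by
  obtain ⟨n, rfl | rfl⟩ : ∃ n, k = 2 * n ∨ k = 2 * n + 1 := ⟨k / 2, by omega⟩
  · rw [chain_even, chain_odd, interlace_even]
    exact ⟨_, isStep_eVec _ _, isK_iff.mp (hK n n)⟩
  · rw [chain_odd, show 2 * n + 1 + 1 = 2 * (n + 1) by ring, chain_even, interlace_odd]
    exact ⟨_, isStep_dVec _ _, isKTilde_iff.mp (hKt (n + 1) n)⟩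

theorem orthonormal_interlace {K Kt : ℤ → ℤ → LR R} (hK : ∀ n m, IsK R n m (K n m))
    (hKt : ∀ n m, IsKTilde R n m (Kt n m)) : Orthonormal ℂ (interlace K Kt) := by
  choose e he hv using exists_step_chain hK hKt
  exact orthonormal_of_chain chain_antitone (fun k => (hv k).mem) (fun k => (hv k).mem_orthogonal)
    fun k => (hv k).norm_eq

theorem span_interlace_orthogonal {K Kt : ℤ → ℤ → LR R} (hK : ∀ n m, IsK R n m (K n m))
    (hKt : ∀ n m, IsKTilde R n m (Kt n m)) :
    (Submodule.span ℂ (Set.range (interlace K Kt)))ᗮ = ⊥ := by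
  choose e he hv using exists_step_chain hK hKt
  refine span_orthogonal_eq_bot_of_chain chain_antitone (fun k => (hv k).mem_orthogonal)
    (fun k => (hv k).mem) (fun k => (hv k).norm_eq)
    (fun k x hx h0 => (he k).mem_of_inner_eq_zero (hv k) hx h0) (fun x hx => ?_) fun x hx => ?_
  · exact eq_zero_of_forall_mem_H fun n => chain_even (R := R) n ▸ hx (2 * n)
  · exact eq_zero_of_forall_mem_orthogonal_H fun n => chain_even (R := R) n ▸ hx (2 * n)

end ScatteringCMV

/-! ### Assembly: recursion, shift formula and CMV matrix. -/

theorem mainTheorem1 (R : SzegoFunction) :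
    -- the chain of subspaces is decreasing with steps of codimension one
    (∀ n m : ℤ, IsCodimOne (H R (n + 1) m) (H R n m) ∧ IsCodimOne (H R n (m + 1)) (H R n m)) ∧
    ∃ (K Kt : ℤ → ℤ → LR R) (α : ℤ → ℂ),
      -- the normalized vectors `K n m` and `Kt n m` exist and are unique
      (∀ (n m : ℤ) (x : LR R), IsK R n m x ↔ x = K n m) ∧
      (∀ (n m : ℤ) (x : LR R), IsKTilde R n m x ↔ x = Kt n m) ∧
      -- the Verblunsky coefficients
      (∀ k : ℤ, ‖α k‖ < 1) ∧
      (∀ n m : ℤ, inner ℂ (Kt n m) (K n m) = α (n + m)) ∧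
      (∀ n m : ℤ,
        K n m = α (n + m) • Kt n m + (rho (α (n + m)) : ℂ) • K n (m + 1) ∧
        Kt (n + 1) m = (rho (α (n + m)) : ℂ) • Kt n m - conj (α (n + m)) • K n (m + 1)) ∧
      -- the formula for the action of `U_R` on the vectors of the basis
      (∀ n : ℤ, ∀ j : Fin 2,
        UR R (![K n n, Kt (n + 1) n] j) =
          ∑ i : Fin 4,
            (!![(rho (α (2 * n - 1)) : ℂ), 0;
                -conj (α (2 * n - 1)), 0;
                0, α (2 * n + 1);
                0, (rho (α (2 * n + 1)) : ℂ)] * block (α (2 * n))) i j •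
              ![Kt n (n - 1), K n n, Kt (n + 1) n, K (n + 1) (n + 1)] i) ∧
      -- the vectors form an orthonormal basis in which `U_R` has a CMV matrix
      ∃ b : HilbertBasis ℤ ℂ (LR R),
        (∀ n : ℤ, b (2 * n) = K n n ∧ b (2 * n + 1) = Kt (n + 1) n) ∧
        ∀ i j : ℤ, inner ℂ (b i) (UR R (b j)) = cmvMatrix α i j := by
  refine ⟨fun n m => ⟨(isStep_eVec n m).isCodimOne, (isStep_dVec n m).isCodimOne⟩, ?_⟩
  have exK : ∀ n m, ∃ x, IsK R n m x := fun n m =>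
    (isStep_eVec n m).exists_isNormalVec.imp fun _ h => isK_iff.mpr h
  have exKt : ∀ n m, ∃ x, IsKTilde R n m x := fun n m =>
    (isStep_dVec n m).exists_isNormalVec.imp fun _ h => isKTilde_iff.mpr h
  choose K hK using exK
  choose Kt hKt using exKt
  have uK : ∀ n m x, IsK R n m x ↔ x = K n m := fun n m x =>
    ⟨fun h => (isStep_eVec n m).eq_of_isNormalVec (isK_iff.mp h) (isK_iff.mp (hK n m)),
      fun h => h ▸ hK n m⟩
  have uKt : ∀ n m x, IsKTilde R n m x ↔ x = Kt n m := fun n m x =>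
    ⟨fun h => (isStep_dVec n m).eq_of_isNormalVec (isKTilde_iff.mp h) (isKTilde_iff.mp (hKt n m)),
      fun h => h ▸ hKt n m⟩
  have UK : ∀ n m, UR R (K n m) = K (n + 1) (m - 1) := fun n m => (uK _ _ _).mp (hK n m).UR
  have UKt : ∀ n m, UR R (Kt n m) = Kt (n + 1) (m - 1) := fun n m => (uKt _ _ _).mp (hKt n m).UR
  have hα : ∀ n m, (inner ℂ (Kt n m) (K n m) : ℂ) = inner ℂ (Kt (n + m) 0) (K (n + m) 0) :=
    eq_of_shift_invariant (g := fun n m => (inner ℂ (Kt n m) (K n m) : ℂ)) fun n m => by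
      rw [← UK, ← UKt, LinearIsometryEquiv.inner_map_map]
  set α : ℤ → ℂ := fun k => inner ℂ (Kt k 0) (K k 0)
  have hrec : ∀ n m, ‖α (n + m)‖ < 1 ∧
      K n m = α (n + m) • Kt n m + (rho (α (n + m)) : ℂ) • K n (m + 1) ∧
      Kt (n + 1) m = (rho (α (n + m)) : ℂ) • Kt n m - conj (α (n + m)) • K n (m + 1) :=
    fun n m => by
      have := szego_recursion (isStep_eVec n m) (isStep_dVec n m) (isStep_eVec n (m + 1))
        (isStep_dVec (n + 1) m) (isK_iff.mp (hK n m)) (isKTilde_iff.mp (hKt n m))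
        (isK_iff.mp (hK n (m + 1))) (isKTilde_iff.mp (hKt (n + 1) m))
      rwa [hα n m] at this
  -- The vectors `Kt (n + 1) (n - 1)` and `K (n + 1) n` form the intermediate family. `w0` and `w1`
  -- expand it in the basis by the odd blocks; `u0` and `u1` expand the image of the basis under
  -- `U_R` in it by the even blocks.
  have w0 : ∀ n, Kt (n + 1) (n - 1) =
      (rho (α (2 * n - 1)) : ℂ) • Kt n (n - 1) - conj (α (2 * n - 1)) • K n n := fun n => by
    have := (hrec n (n - 1)).2.2
    rwa [show n + (n - 1) = 2 * n - 1 by ring, sub_add_cancel] at this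
  have w1 : ∀ n, K (n + 1) n =
      α (2 * n + 1) • Kt (n + 1) n + (rho (α (2 * n + 1)) : ℂ) • K (n + 1) (n + 1) := fun n => by
    have := (hrec (n + 1) n).2.1
    rwa [show n + 1 + n = 2 * n + 1 by ring] at this
  have u0 : ∀ n, UR R (K n n) =
      α (2 * n) • Kt (n + 1) (n - 1) + (rho (α (2 * n)) : ℂ) • K (n + 1) n := fun n => by
    have := congrArg (UR R) (hrec n n).2.1
    rwa [map_add, map_smul, map_smul, UKt, UK n (n + 1), add_sub_cancel_right, ← two_mul] at this
  have u1 : ∀ n, UR R (Kt (n + 1) n) =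
      (rho (α (2 * n)) : ℂ) • Kt (n + 1) (n - 1) - conj (α (2 * n)) • K (n + 1) n := fun n => by
    have := congrArg (UR R) (hrec n n).2.2
    rwa [map_sub, map_smul, map_smul, UKt n n, UK, add_sub_cancel_right, ← two_mul] at this
  refine ⟨K, Kt, α, uK, uKt, fun k => ?_, hα, fun n m => (hrec n m).2, fun n j => ?_, ?_⟩
  · simpa using (hrec k 0).1
  · fin_cases j
    · simp only [Fin.zero_eta, Matrix.cons_val_zero, Fin.sum_univ_four, Matrix.mul_apply,
        Fin.sum_univ_two, u0, w0, w1, block]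
      simp
      module
    · simp only [Fin.mk_one, Matrix.cons_val_one, Matrix.cons_val_fin_one, Fin.sum_univ_four,
        Matrix.mul_apply, Fin.sum_univ_two, u1, w0, w1, block]
      simp
      module
  · have hon := orthonormal_interlace hK hKt
    refine ⟨HilbertBasis.mkOfOrthogonalEqBot hon (span_interlace_orthogonal hK hKt), ?_, ?_⟩
    · simp only [HilbertBasis.coe_mkOfOrthogonalEqBot]
      exact fun n => ⟨interlace_even K Kt n, interlace_odd K Kt n⟩
    · simp only [HilbertBasis.coe_mkOfOrthogonalEqBot]
      have hin := orthonormal_iff_ite.mp hon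
      set b := interlace K Kt
      have b0 : ∀ n, K n n = b (2 * n) := fun n => (interlace_even K Kt n).symm
      have b1 : ∀ n, Kt (n + 1) n = b (2 * n + 1) := fun n => (interlace_odd K Kt n).symm
      -- The coordinates of the intermediate vectors are the columns of the odd factor; column `2 *
      -- n` is the right column of the block that starts at `2 * n - 1`.
      have M0 : ∀ i n, inner ℂ (b i) (Kt (n + 1) (n - 1)) = blockDiag α 1 i (2 * n) := by
        intro i n
        have h1 : Kt n (n - 1) = b (2 * n - 1) := by
          have := b1 (n - 1)
          rwa [sub_add_cancel, show 2 * (n - 1) + 1 = 2 * n - 1 by ring] at this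
        have h2 := blockDiag_right_column α (p := 1) (k := 2 * n - 1) ⟨n - 1, by ring⟩ i
        rw [sub_add_cancel] at h2
        rw [w0, h1, b0, inner_sub_right, inner_smul_right, inner_smul_right, hin, hin, h2]
        split_ifs <;> first | omega | simp
      have M1 : ∀ i n, inner ℂ (b i) (K (n + 1) n) = blockDiag α 1 i (2 * n + 1) := by
        intro i n
        rw [w1, b1, b0, inner_add_right, inner_smul_right, inner_smul_right, hin, hin,
          blockDiag_left_column α (p := 1) (k := 2 * n + 1) ⟨n, by ring⟩]
        split_ifs <;> first | omega | simp
      intro i j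
      have hd : ∀ n : ℤ, (2 : ℤ) ∣ 2 * n - 0 := fun n => ⟨n, by ring⟩
      obtain ⟨n, rfl | rfl⟩ : ∃ n, j = 2 * n ∨ j = 2 * n + 1 := ⟨j / 2, by omega⟩
      · rw [cmvMatrix_apply α n i _ (Or.inl rfl), ← b0, u0, inner_add_right, inner_smul_right,
          inner_smul_right, M0, M1, blockDiag_left_column α (hd n),
          blockDiag_left_column α (hd n)]
        simp [mul_comm]
      · rw [cmvMatrix_apply α n i _ (Or.inr rfl), ← b1, u1, inner_sub_right, inner_smul_right,
          inner_smul_right, M0, M1, blockDiag_right_column α (hd n),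
          blockDiag_right_column α (hd n)]
        simp
        ring
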